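/- Let $(\overline M,\overline g)$ be a connected smooth semi-Riemannian manifold of dimension $n+1$ with Levi-Civita connection $\overline\nabla$, and let $x:M\to\overline M$ be a smooth embedding of a connected $n$-dimensional manifold which is a null hypersurface, i.e. $g=x^\star\overline g$ is degenerate at every point. Let $N$ be a smooth lightlike (nowhere zero, null) vector field on $\overline M$ which is nowhere tangent to $M$, put $\overline\eta=\overline g(N,\cdot)$ and $\eta=x^\star\overline\eta$, and suppose that $\overline\eta$ is closed. Let $\mathscr S(N)=\ker\eta\subset TM$ be the screen distribution, let $\xi$ be the unique section of $Rad(TM)=TM\cap TM^\perp$ with $\overline g(\xi,N)=1$, and let $\nabla$ be the connection on $M$ obtained from $\overline\nabla$ by projection along $N$. Define $\tau(X)=\overline g(\overline\nabla_XN,\xi)$ and the shape operators $A_N$ and $\overset{\star}{A}_\xi$ by $$\overline\nabla_XN=-A_NX+\tau(X)N,\qquad \nabla_X\xi=-\overset{\star}{A}_\xi X-\tau(X)\xi .$$ Let $\alpha$ be a nowhere vanishing smooth function on $\overline M$ whose restriction to $M$ is constant on each leaf of $\mathscr S(N)$, and suppose that the screen distribution is conformal with conformal factor $1/\alpha$,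 i.e. $A_N=\frac1\alpha\overset{\star}{A}_\xi$ on $M$. Put $\overline g_\alpha=\overline g+\alpha\,\overline\eta\otimes\overline\eta$ on $\overline M$ and $g_\alpha=g+\alpha\,\eta\otimes\eta$ on $M$. Then $\overline g_\alpha$ and $g_\alpha$ are semi-Riemannian metrics, $g_\alpha=x^\star\overline g_\alpha$, and hence $x:(M,g_\alpha)\to(\overline M,\overline g_\alpha)$ is a non-degenerate hypersurface. The field $\delta_\alpha=\sqrt{|\alpha|}\,N-\frac{\mathrm{sign}(\alpha)}{\sqrt{|\alpha|}}\,\xi$ is a smooth normal field along it with $\overline g_\alpha(\delta_\alpha,\delta_\alpha)=-\mathrm{sign}(\alpha)$. Let $A_{\delta_\alpha}X=-(\overline\nabla_\alpha)_X\delta_\alpha$ be its shape operator, where $\overline\nabla_\alpha$ is the Levi-Civita connection of $\overline g_\alpha$, and put $$\lambda=-\frac{\mathrm{sign}(\alpha)}{2\sqrt{|\alpha|}}\left[2\tau(\xi)+\eta(d\alpha^{\#})+d\alpha(N)\right],$$ where $d\alpha^{\#}$ is the vector field on $M$ that is $g_\alpha$-metrically equivalent to $d(\alpha|_M)$. At every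 point of $M$ one has $TM=\mathscr S(N)\oplus Rad(TM)$, where $\mathscr S(N)$ has dimension $n-1$ and $Rad(TM)$ has dimension $1$; moreover $A_{\delta_\alpha}=0$ on $\mathscr S(N)$ and $A_{\delta_\alpha}=\lambda\,\mathrm{id}$ on $Rad(TM)$. Thus there are at most two principal curvatures, $0$ and $\lambda$, and at each point where $\lambda\neq0$ the eigenspace of $0$ is $\mathscr S(N)$ (multiplicity $n-1$) and the eigenspace of $\lambda$ is $Rad(TM)$ (multiplicity $1$). -/

import Mathlib

open scoped Manifold ContDiff Bundle
open Bundle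

noncomputable section

namespace RiggedNull

/-- A (not necessarily smooth) vector field on an `m`-dimensional manifold. -/
abbrev VectorField (m : ℕ) (M : Type*) [TopologicalSpace M]
    [ChartedSpace (EuclideanSpace ℝ (Fin m)) M] : Type _ :=
  ∀ p : M, TangentSpace (𝓡 m) p

/-- A (not necessarily smooth) field of linear forms on an `m`-dimensional manifold. -/
abbrev OneForm (m : ℕ) (M : Type*) [TopologicalSpace M]
    [ChartedSpace (EuclideanSpace ℝ (Fin m)) M] : Type _ :=
  ∀ p : M, TangentSpace (𝓡 m) p →L[ℝ] ℝ

/-- A (not necessarily smooth) field of bilinear forms on an `m`-dimensional manifold. -/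
abbrev BilinField (m : ℕ) (M : Type*) [TopologicalSpace M]
    [ChartedSpace (EuclideanSpace ℝ (Fin m)) M] : Type _ :=
  ∀ p : M, TangentSpace (𝓡 m) p →L[ℝ] TangentSpace (𝓡 m) p →L[ℝ] ℝ

section General

variable {m : ℕ} {M : Type*} [TopologicalSpace M] [ChartedSpace (EuclideanSpace ℝ (Fin m)) M]
  [IsManifold (𝓡 m) ∞ M]

/-- Semi-Riemannian metrics: smooth symmetric non-degenerate fields of bilinear forms. (On a
connected manifold the index of such a field is automatically constant.) -/
structure IsSemiRiemannianMetric (g : BilinField m M) : Prop where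
  smooth : ContMDiff (𝓡 m)
    ((𝓡 m).prod 𝓘(ℝ, EuclideanSpace ℝ (Fin m) →L[ℝ] EuclideanSpace ℝ (Fin m) →L[ℝ] ℝ)) ∞
    (fun p ↦ TotalSpace.mk' (EuclideanSpace ℝ (Fin m) →L[ℝ] EuclideanSpace ℝ (Fin m) →L[ℝ] ℝ)
      (E := fun p : M ↦ TangentSpace (𝓡 m) p →L[ℝ] TangentSpace (𝓡 m) p →L[ℝ] ℝ) p (g p))
  symm : ∀ (p : M) (u v : TangentSpace (𝓡 m) p), g p u v = g p v u
  nondegenerate : ∀ (p : M) (u : TangentSpace (𝓡 m) p),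
    (∀ v : TangentSpace (𝓡 m) p, g p u v = 0) → u = 0

/-- The tangent vector at the point with coordinates `y` in the preferred chart at `p` whose
components in that chart are given. -/
def chartFrame (p : M) (y : EuclideanSpace ℝ (Fin m)) :
    EuclideanSpace ℝ (Fin m) →L[ℝ] TangentSpace (𝓡 m) ((extChartAt (𝓡 m) p).symm y) :=
  (trivializationAt (EuclideanSpace ℝ (Fin m)) (TangentSpace (𝓡 m)) p).symmL ℝ
    ((extChartAt (𝓡 m) p).symm y)

/-- The components `θ_i` of a one-form in the preferred chart at `p`, as functions of the
coordinates. -/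
def oneFormInChart (θ : OneForm m M) (p : M) (y : EuclideanSpace ℝ (Fin m)) :
    EuclideanSpace ℝ (Fin m) →L[ℝ] ℝ :=
  (θ ((extChartAt (𝓡 m) p).symm y)).comp (chartFrame p y)

/-- The components `g_ij` of a field of bilinear forms in the preferred chart at `p`, as functions
of the coordinates. -/
def bilinInChart (g : BilinField m M) (p : M) (y : EuclideanSpace ℝ (Fin m)) :
    EuclideanSpace ℝ (Fin m) →L[ℝ] EuclideanSpace ℝ (Fin m) →L[ℝ] ℝ :=
  (ContinuousLinearMap.precomp ℝ (chartFrame p y)).comp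
    ((g ((extChartAt (𝓡 m) p).symm y)).comp (chartFrame p y))

/-- A one-form is closed, `dθ = 0`: in the chart at any point `p`, one has
`∂_i θ_j = ∂_j θ_i` at `p`. -/
def IsClosedForm (θ : OneForm m M) : Prop :=
  ∀ (p : M) (u v : EuclideanSpace ℝ (Fin m)),
    fderiv ℝ (oneFormInChart θ p) (extChartAt (𝓡 m) p p) u v =
      fderiv ℝ (oneFormInChart θ p) (extChartAt (𝓡 m) p p) v u

/-- The Christoffel symbols of `g` at `p` in the preferred chart at `p`: `christoffel g p u v` is
the vector `Γ` with `2 g(Γ, w) = D_u g(v, w) + D_v g(u, w) - D_w g(u, v)` for all `w`. -/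
def christoffel (g : BilinField m M) (p : M) (u v : EuclideanSpace ℝ (Fin m)) :
    EuclideanSpace ℝ (Fin m) :=
  let D := fderiv ℝ (bilinInChart g p) (extChartAt (𝓡 m) p p)
  (bilinInChart g p (extChartAt (𝓡 m) p p)).inverse
    ((1 / 2 : ℝ) • (D u v + D v u - (D.flip u).flip v))

/-- The Levi-Civita covariant derivative of `g` along a map `f : N → M`: for a vector field `V`
along `f` and `v ∈ T_pN` this is `∇_v V = dV(v) + Γ(df(v), V)`, computed in the preferred chart
of `M` at `f p` (through which `T_{f p}M` is identified with the model space).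
For `f = id` it is the Levi-Civita connection of `(M, g)`. -/
def covDerivAlong (g : BilinField m M) {k : ℕ} {N : Type*} [TopologicalSpace N]
    [ChartedSpace (EuclideanSpace ℝ (Fin k)) N] (f : N → M)
    (V : ∀ q : N, TangentSpace (𝓡 m) (f q)) (p : N) (v : TangentSpace (𝓡 k) p) :
    TangentSpace (𝓡 m) (f p) :=
  (mvfderiv (𝓡 k) (fun q ↦ (trivializationAt (EuclideanSpace ℝ (Fin m)) (TangentSpace (𝓡 m))
      (f p)).continuousLinearMapAt ℝ (f q) (V q)) p v : EuclideanSpace ℝ (Fin m)) +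
    christoffel g (f p) (mfderiv (𝓡 k) (𝓡 m) f p v) (V p)

/-- The vector `θ^#` with `g(θ^#, ·) = θ`. -/
def sharp (g : BilinField m M) (θ : OneForm m M) : VectorField m M :=
  fun p ↦ (g p).inverse (θ p)

/-- The leaf through `p` of an integrable distribution `S`: the set of points which can be reached
from `p` along smooth curves tangent to `S`. -/
def leaf (S : ∀ p : M, Submodule ℝ (TangentSpace (𝓡 m) p)) (p : M) : Set M :=
  {q | ∃ γ : ℝ → M, ContMDiff 𝓘(ℝ, ℝ) (𝓡 m) ∞ γ ∧ γ 0 = p ∧ γ 1 = q ∧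
    ∀ t : ℝ, mfderiv 𝓘(ℝ, ℝ) (𝓡 m) γ t (1 : ℝ) ∈ S (γ t)}

/-- `f` is constant on each leaf of the distribution `S`. -/
def ConstantOnLeaves (S : ∀ p : M, Submodule ℝ (TangentSpace (𝓡 m) p)) (f : M → ℝ) : Prop :=
  ∀ p : M, ∀ q ∈ leaf S p, f q = f p

/-- The one-form `g(N, ·)` metrically equivalent to `N`. -/
def flat (g : BilinField m M) (N : VectorField m M) : OneForm m M :=
  fun p ↦ g p (N p)

/-- The field of bilinear forms `g + a θ ⊗ θ`. -/
def addSq (g : BilinField m M) (a : M → ℝ) (θ : OneForm m M) : BilinField m M :=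
  fun p ↦ g p + a p • ContinuousLinearMap.smulRight (θ p) (θ p)

end General

section Hypersurface

variable {n : ℕ}
  {Mb : Type*} [TopologicalSpace Mb] [ChartedSpace (EuclideanSpace ℝ (Fin (n + 1))) Mb]
  [IsManifold (𝓡 (n + 1)) ∞ Mb]
  {M : Type*} [TopologicalSpace M] [ChartedSpace (EuclideanSpace ℝ (Fin n)) M]
  [IsManifold (𝓡 n) ∞ M]

/-- The differential of `x : M → Mb` at `p`. -/
abbrev dx (x : M → Mb) (p : M) :
    TangentSpace (𝓡 n) p →L[ℝ] TangentSpace (𝓡 (n + 1)) (x p) :=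
  mfderiv (𝓡 n) (𝓡 (n + 1)) x p

/-- The pullback `x^* θ` of a one-form. -/
def pullForm (x : M → Mb) (θ : OneForm (n + 1) Mb) : OneForm n M :=
  fun p ↦ (θ (x p)).comp (dx x p)

/-- The pullback `x^* g` of a field of bilinear forms. -/
def pullBilin (x : M → Mb) (g : BilinField (n + 1) Mb) : BilinField n M :=
  fun p ↦ (ContinuousLinearMap.precomp ℝ (dx x p)).comp ((g (x p)).comp (dx x p))

/-- The radical `Rad(TM) = TM ∩ TM^⊥` of the induced form `x^* g`, at `p`. -/
def radical (gb : BilinField (n + 1) Mb) (x : M → Mb) (p : M) :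
    Submodule ℝ (TangentSpace (𝓡 n) p) :=
  LinearMap.ker (pullBilin x gb p).toLinearMap

/-- The hypersurface is null: the induced form is degenerate at each point. -/
def IsNullHypersurface (gb : BilinField (n + 1) Mb) (x : M → Mb) : Prop :=
  ∀ p : M, ∃ u : TangentSpace (𝓡 n) p, u ≠ 0 ∧ u ∈ radical gb x p

variable (gb : BilinField (n + 1) Mb) (x : M → Mb) (N : VectorField (n + 1) Mb)

/-- The one-form `η = x^* (gb(N, ·))`. -/
def eta : OneForm n M := pullForm x (flat gb N)

/-- The screen distribution `ker η`. -/
def screen (p : M) : Submodule ℝ (TangentSpace (𝓡 n) p) :=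
  LinearMap.ker (eta gb x N p).toLinearMap

/-- The rigged field `ξ`: the unique section of `Rad(TM)` with `gb(ξ, N) = 1`. -/
def rigged : VectorField n M :=
  fun p ↦ Classical.epsilon fun u : TangentSpace (𝓡 n) p ↦
    u ∈ radical gb x p ∧ eta gb x N p u = 1

/-- The rigged field seen as a vector field along `x`. -/
def riggedAlong (p : M) : TangentSpace (𝓡 (n + 1)) (x p) :=
  dx x p (rigged gb x N p)

/-- The projection of `T_{x p}Mb = T_pM ⊕ ℝ N` onto `T_pM` along `N`
(`T_pM` being identified with its image under `dx`): the coefficient of `N` in `w` is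
`gb(w, ξ)`. -/
def tangentPart (p : M) (w : TangentSpace (𝓡 (n + 1)) (x p)) :
    TangentSpace (𝓡 (n + 1)) (x p) :=
  w - gb (x p) w (riggedAlong gb x N p) • N (x p)

/-- The rotation one-form `τ(X) = gb(∇_X N, ξ)`. -/
def tau (p : M) (v : TangentSpace (𝓡 n) p) : ℝ :=
  gb (x p) (covDerivAlong gb x (fun q ↦ N (x q)) p v) (riggedAlong gb x N p)

/-- The shape operator `A_N` of the hypersurface: `∇_X N = - A_N X + τ(X) N`. -/
def shapeN (p : M) (v : TangentSpace (𝓡 n) p) : TangentSpace (𝓡 (n + 1)) (x p) :=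
  -tangentPart gb x N p (covDerivAlong gb x (fun q ↦ N (x q)) p v)

/-- The shape operator `A*_ξ` of the screen distribution: `∇^M_X ξ = - A*_ξ X - τ(X) ξ`, where
`∇^M` is the connection induced on `M` by projection along `N`. -/
def shapeXi (p : M) (v : TangentSpace (𝓡 n) p) : TangentSpace (𝓡 (n + 1)) (x p) :=
  -tangentPart gb x N p (covDerivAlong gb x (riggedAlong gb x N) p v)
    - tau gb x N p v • riggedAlong gb x N p

/-- The screen distribution is conformal with conformal factor `φ`: `A_N = φ A*_ξ`. -/
def HasConformalScreen (φ : M → ℝ) : Prop :=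
  ∀ (p : M) (v : TangentSpace (𝓡 n) p), shapeN gb x N p v = φ p • shapeXi gb x N p v

variable (α : Mb → ℝ)

/-- The twisted field `gb_α = gb + α ηb ⊗ ηb` on `Mb`, where `ηb = gb(N, ·)`. -/
def twisted : BilinField (n + 1) Mb := addSq gb α (flat gb N)

/-- The associated field `g_α = g + α η ⊗ η` on `M`, where `g = x^* gb`. -/
def associated : BilinField n M := addSq (pullBilin x gb) (fun p ↦ α (x p)) (eta gb x N)

/-- The field `δ_α = √|α| N - (sign α / √|α|) ξ` along `x`. -/
def gaussMap (p : M) : TangentSpace (𝓡 (n + 1)) (x p) :=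
  √|α (x p)| • N (x p) - (Real.sign (α (x p)) / √|α (x p)|) • riggedAlong gb x N p

/-- The number `-(sign α / (2 √|α|)) (2 τ(ξ) + η(dα^#) + dα(N))` at `p`, where `#` is taken with
respect to `g_α`. -/
def curvatureValue (p : M) : ℝ :=
  -(Real.sign (α (x p)) / (2 * √|α (x p)|)) *
    (2 * tau gb x N p (rigged gb x N p)
      + eta gb x N p (sharp (associated gb x N α) (fun q ↦ mvfderiv (𝓡 n) (fun r ↦ α (x r)) q) p)
      + mvfderiv (𝓡 (n + 1)) α (x p) (N (x p)))

/-- `δ` is a smooth unit normal field (of square `ε = ±1`) of the hypersurface `x` with respect to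
the metric `h` of the ambient manifold. -/
structure IsUnitNormal (h : BilinField (n + 1) Mb) (x : M → Mb)
    (δ : ∀ p : M, TangentSpace (𝓡 (n + 1)) (x p)) (ε : M → ℝ) : Prop where
  smooth : ContMDiff (𝓡 n) (𝓡 (n + 1)).tangent ∞
    (fun p ↦ (⟨x p, δ p⟩ : TangentBundle (𝓡 (n + 1)) Mb))
  normal : ∀ (p : M) (v : TangentSpace (𝓡 n) p), h (x p) (δ p) (dx x p v) = 0
  unit : ∀ p : M, h (x p) (δ p) (δ p) = ε p
  sign : ∀ p : M, ε p = 1 ∨ ε p = -1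

/-- `A` is the shape operator (Weingarten endomorphism) of the hypersurface `x` with respect to
the ambient metric `h` and the unit normal `δ`: `∇_v δ = - A v`, where `∇` is the Levi-Civita
connection of `h`. -/
def IsShapeOperator (h : BilinField (n + 1) Mb) (x : M → Mb)
    (δ : ∀ p : M, TangentSpace (𝓡 (n + 1)) (x p))
    (A : ∀ p : M, Module.End ℝ (TangentSpace (𝓡 n) p)) : Prop :=
  ∀ (p : M) (v : TangentSpace (𝓡 n) p), covDerivAlong h x δ p v = -dx x p (A p v)

end Hypersurface

end RiggedNull

end

/-!
Write `θ = gb(N, ·)`, `∇` for the Levi-Civita connection of `gb` and `∇^α` for that of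
`gb_α = gb + α θ ⊗ θ`. The Koszul formula gives the difference of the two connections: as `θ` is
closed, `(u, v) ↦ gb(∇_u N, v)` is symmetric and
`∇^α_u v = ∇_u v + (½ (dα(u) θ(v) + dα(v) θ(u)) + α gb(∇_u N, v)) N - ½ θ(u) θ(v) grad_α α`,
with `grad_α` the gradient for `gb_α` (`localChristoffel_localTwist`; the coefficient of `N` is
simpler than one expects because `gb_α(N, ·) = θ`, `N` being null).

Applied to `δ = √|α| N - (sign α / √|α|) ξ` along the hypersurface, this is a multiple of `ξ`, for
three reasons.

* Conformality of the screen says `∇_v ξ = α ∇_v N - α τ(v) N - τ(v) ξ`. The second fundamental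
  form `gb(∇_v ξ, w)` is symmetric in the tangent vectors `v` and `w`, and it vanishes when
  `v = ξ`, since then it equals `gb(∇_w ξ, ξ) = ½ w (gb(ξ, ξ)) = 0`. Hence
  `gb(∇_ξ N, w) = τ(ξ) η(w)`, and by closedness of `θ` the left side is `gb(∇_w N, ξ) = τ(w)`:
  the rotation form is `τ = τ(ξ) η`.
* `α` is constant on the leaves of `ker η`, so `dα` vanishes on `ker η`, that is,
  `dα = dα(ξ) η` on `M`. A leaf being the set of points reached along smooth curves tangent to
  `ker η`, this requires a curve, defined for all time, through a given vector of `ker η`: an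
  integral curve of a suitable section of `ker η` in a chart, reparametrised
  (`IsNullRigging.mvfderiv_eq_zero_of_mem_screen`).
* Therefore `grad_α α` is, along `M`, a combination of `N` and `ξ`, and everything is
  proportional to `η`.

Collecting terms yields `∇^α_v δ = -λ η(v) ξ` with the stated `λ`: see `covDeriv_localTwist` for the
computation in coordinates and `IsNullRigging.covDerivAlong_gaussMap` for the result on the
manifold. So the shape operator is `λ η ⊗ ξ`, and the eigenspaces are read off from
`TM = ker η ⊕ ℝ ξ`.

The rigged field `ξ` is only given pointwise. Its smoothness, needed to differentiate `δ`, holds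
because it is the vector field dual to `η` for the smooth non-degenerate form `g + η ⊗ η`
(`IsNullRigging.contDiffAt_rigged`).

All differential computations take place in the preferred charts at a point `p` of `M` and at
its image. There the hypersurface is a map `X` between normed spaces, tensor fields become functions
of the coordinates, and `covDerivAlong` becomes `D V + Γ(DX ·, V)`.
-/


noncomputable section

open scoped Topology
open Filter

set_option maxSynthPendingDepth 3
set_option linter.unusedSectionVars false

namespace RiggedNull

/-! ### The Levi-Civita connection in a chart -/

section Local

variable {E F : Type*} [NormedAddCommGroup E] [NormedSpace ℝ E]
  [NormedAddCommGroup F] [NormedSpace ℝ F]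

/-- The Christoffel symbols at `y` of a field `G` of bilinear forms on a normed space. -/
def localChristoffel (G : E → E →L[ℝ] E →L[ℝ] ℝ) (y u v : E) : E :=
  (G y).inverse
    ((1 / 2 : ℝ) • (fderiv ℝ G y u v + fderiv ℝ G y v u - ((fderiv ℝ G y).flip u).flip v))

variable {G : E → E →L[ℝ] E →L[ℝ] ℝ} {y : E}

lemma localChristoffel_apply (hG : (G y).IsInvertible) (u v w : E) :
    G y (localChristoffel G y u v) w =
      1 / 2 * (fderiv ℝ G y u v w + fderiv ℝ G y v u w - fderiv ℝ G y w u v) := by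
  obtain ⟨e, he⟩ := hG
  have h : G y (localChristoffel G y u v) = (1 / 2 : ℝ) •
      (fderiv ℝ G y u v + fderiv ℝ G y v u - ((fderiv ℝ G y).flip u).flip v) := by
    rw [localChristoffel, ← he, ContinuousLinearMap.inverse_equiv]
    simp
  rw [h]
  simp

lemma localChristoffel_sub_smul (u v w : E) (b c : ℝ) :
    localChristoffel G y u (b • v - c • w) =
      b • localChristoffel G y u v - c • localChristoffel G y u w := by
  simp only [localChristoffel, ← map_smul, ← map_sub]
  congr 1
  ext z
  simp
  ring

lemma fderiv_symm (hd : DifferentiableAt ℝ G y)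
    (hs : ∀ᶠ y' in 𝓝 y, ∀ u v, G y' u v = G y' v u) (u v w : E) :
    fderiv ℝ G y u v w = fderiv ℝ G y u w v := by
  have key : ∀ a b : E, fderiv ℝ (fun y' ↦ G y' a b) y u = fderiv ℝ G y u a b := fun a b ↦ by
    have h1 := hd.hasFDerivAt.clm_apply (hasFDerivAt_const a y)
    have h2 := h1.clm_apply (hasFDerivAt_const b y)
    rw [h2.fderiv]
    simp
  rw [← key, ← key]
  have : (fun y' ↦ G y' v w) =ᶠ[𝓝 y] fun y' ↦ G y' w v := hs.mono fun _ h ↦ h v w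
  rw [this.fderiv_eq]

/-- The Levi-Civita connection of `G` is metric: the product rule for vector fields along a map. -/
lemma fderiv_metric {X V W : F → E} {X' V' W' : F →L[ℝ] E} {z : F}
    (hG : (G (X z)).IsInvertible) (hd : DifferentiableAt ℝ G (X z))
    (hs : ∀ᶠ y' in 𝓝 (X z), ∀ u v, G y' u v = G y' v u)
    (hX : HasFDerivAt X X' z) (hV : HasFDerivAt V V' z) (hW : HasFDerivAt W W' z) (e : F) :
    fderiv ℝ (fun z' ↦ G (X z') (V z') (W z')) z e =
      G (X z) (V' e + localChristoffel G (X z) (X' e) (V z)) (W z) +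
        G (X z) (V z) (W' e + localChristoffel G (X z) (X' e) (W z)) := by
  have h1 : HasFDerivAt (fun z' ↦ G (X z')) ((fderiv ℝ G (X z)).comp X') z :=
    hd.hasFDerivAt.comp z hX
  have h2 := h1.clm_apply hV
  have h := h2.clm_apply hW
  have h' : fderiv ℝ (fun z' ↦ G (X z') (V z') (W z')) z e =
      fderiv ℝ G (X z) (X' e) (V z) (W z) + G (X z) (V' e) (W z) + G (X z) (V z) (W' e) := by
    rw [h.fderiv]
    simp
    ring
  rw [h']
  simp only [map_add, add_apply]
  rw [hs.self_of_nhds (V z) (localChristoffel G (X z) (X' e) (W z)),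
    localChristoffel_apply hG, localChristoffel_apply hG]
  have := fderiv_symm hd hs
  rw [this (W z) (X' e) (V z), this (X' e) (W z) (V z), this (V z) (X' e) (W z)]
  ring

/-- Vector fields along a map with constant product: the derivative vanishes. -/
lemma metric_add_metric_eq_zero {X V W : F → E} {X' V' W' : F →L[ℝ] E} {z : F} {c : ℝ}
    (hG : (G (X z)).IsInvertible) (hd : DifferentiableAt ℝ G (X z))
    (hs : ∀ᶠ y' in 𝓝 (X z), ∀ u v, G y' u v = G y' v u)
    (hX : HasFDerivAt X X' z) (hV : HasFDerivAt V V' z) (hW : HasFDerivAt W W' z)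
    (hc : ∀ᶠ z' in 𝓝 z, G (X z') (V z') (W z') = c) (e : F) :
    G (X z) (V' e + localChristoffel G (X z) (X' e) (V z)) (W z) +
      G (X z) (V z) (W' e + localChristoffel G (X z) (X' e) (W z)) = 0 := by
  rw [← fderiv_metric hG hd hs hX hV hW e, EventuallyEq.fderiv_eq (f := fun _ ↦ c) hc]
  simp

/-- If the one-form `G(N, ·)` is closed then `∇N` is a symmetric operator. -/
lemma covDeriv_symm_of_closed {N : E → E} {N' : E →L[ℝ] E}
    (hG : (G y).IsInvertible) (hd : DifferentiableAt ℝ G y)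
    (hs : ∀ᶠ y' in 𝓝 y, ∀ u v, G y' u v = G y' v u) (hN : HasFDerivAt N N' y)
    (hclosed : ∀ u v, fderiv ℝ (fun y' ↦ G y' (N y')) y u v =
      fderiv ℝ (fun y' ↦ G y' (N y')) y v u) (u v : E) :
    G y (N' u + localChristoffel G y u (N y)) v =
      G y (N' v + localChristoffel G y v (N y)) u := by
  have h := hclosed u v
  rw [(hd.hasFDerivAt.clm_apply hN).fderiv] at h
  simp at h
  simp only [map_add, add_apply]
  rw [localChristoffel_apply hG, localChristoffel_apply hG]
  have := fderiv_symm hd hs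
  rw [this u v (N y), this v u (N y), this (N y) v u]
  linear_combination h

/-- The shape operator of a hypersurface (with respect to a normal field `Z`) is symmetric. -/
lemma covDeriv_normal_symm {X Z : F → E} {Z' : F →L[ℝ] E} {z : F}
    (hG : (G (X z)).IsInvertible) (hd : DifferentiableAt ℝ G (X z))
    (hs : ∀ᶠ y' in 𝓝 (X z), ∀ u v, G y' u v = G y' v u)
    (hX : ContDiffAt ℝ 2 X z) (hZ : HasFDerivAt Z Z' z)
    (hn : ∀ᶠ z' in 𝓝 z, ∀ e, G (X z') (Z z') (fderiv ℝ X z' e) = 0) (e e' : F) :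
    G (X z) (Z' e + localChristoffel G (X z) (fderiv ℝ X z e) (Z z)) (fderiv ℝ X z e') =
      G (X z) (Z' e' + localChristoffel G (X z) (fderiv ℝ X z e') (Z z)) (fderiv ℝ X z e) := by
  have hX1 : HasFDerivAt X (fderiv ℝ X z) z := (hX.differentiableAt (by norm_num)).hasFDerivAt
  have hX2 : HasFDerivAt (fderiv ℝ X) (fderiv ℝ (fderiv ℝ X) z) z :=
    ((hX.fderiv_right (m := 1) (by norm_num)).differentiableAt (by norm_num)).hasFDerivAt
  have hW : ∀ a, HasFDerivAt (fun z' ↦ fderiv ℝ X z' a)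
      ((fderiv ℝ (fderiv ℝ X) z).flip a) z := fun a ↦ by
    convert! hX2.clm_apply (hasFDerivAt_const a z) using 1
    ext; simp
  have h1 := metric_add_metric_eq_zero hG hd hs hX1 hZ (hW e') (hn.mono fun _ h ↦ h e') e
  have h2 := metric_add_metric_eq_zero hG hd hs hX1 hZ (hW e) (hn.mono fun _ h ↦ h e) e'
  have hsymm : fderiv ℝ (fderiv ℝ X) z e e' = fderiv ℝ (fderiv ℝ X) z e' e :=
    (hX.isSymmSndFDerivAt (by simp)) e e'
  have hΓ : localChristoffel G (X z) (fderiv ℝ X z e) (fderiv ℝ X z e') =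
      localChristoffel G (X z) (fderiv ℝ X z e') (fderiv ℝ X z e) := by
    rw [localChristoffel, localChristoffel]
    congr 2
    ext w
    simp only [add_apply, sub_apply, ContinuousLinearMap.flip_apply]
    rw [fderiv_symm hd hs w]
    ring
  simp only [ContinuousLinearMap.flip_apply] at h1 h2
  rw [hsymm, hΓ] at h1
  linear_combination h1 - h2

end Local

/-! ### The Levi-Civita connection of the twisted metric in a chart -/

section LocalTwist

variable {E F : Type*} [NormedAddCommGroup E] [NormedSpace ℝ E]
  [NormedAddCommGroup F] [NormedSpace ℝ F]

/-- The field of bilinear forms `G + a θ ⊗ θ` on a normed space, where `θ = G(N, ·)`. -/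
def localTwist (G : E → E →L[ℝ] E →L[ℝ] ℝ) (a : E → ℝ) (N : E → E) (y : E) :
    E →L[ℝ] E →L[ℝ] ℝ :=
  G y + a y • ContinuousLinearMap.smulRight (G y (N y)) (G y (N y))

variable {G : E → E →L[ℝ] E →L[ℝ] ℝ} {N : E → E} {a : E → ℝ} {y : E} {N' : E →L[ℝ] E}
  {a' : E →L[ℝ] ℝ}

lemma localTwist_apply (u v : E) :
    localTwist G a N y u v = G y u v + a y * (G y (N y) u * G y (N y) v) := by
  simp [localTwist]

lemma fderiv_localTwist (hd : DifferentiableAt ℝ G y) (hN : HasFDerivAt N N' y)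
    (ha : HasFDerivAt a a' y) (u v w : E) :
    fderiv ℝ (localTwist G a N) y u v w = fderiv ℝ G y u v w
      + a' u * (G y (N y) v * G y (N y) w)
      + a y * (fderiv ℝ (fun y' ↦ G y' (N y')) y u v * G y (N y) w
        + G y (N y) v * fderiv ℝ (fun y' ↦ G y' (N y')) y u w) := by
  have hθ : DifferentiableAt ℝ (fun y' ↦ G y' (N y')) y :=
    (hd.hasFDerivAt.clm_apply hN).differentiableAt
  have hT : DifferentiableAt ℝ (localTwist G a N) y := by
    have h1 : DifferentiableAt ℝ (fun y' ↦ ContinuousLinearMap.smulRightL ℝ E (E →L[ℝ] ℝ)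
        (G y' (N y')) (G y' (N y'))) y :=
      (DifferentiableAt.clm_apply
        ((ContinuousLinearMap.smulRightL ℝ E (E →L[ℝ] ℝ)).differentiableAt.comp y hθ) hθ)
    exact hd.add (ha.differentiableAt.smul h1)
  have key : fderiv ℝ (fun y' ↦ localTwist G a N y' v w) y u =
      fderiv ℝ (localTwist G a N) y u v w := by
    have h1 := hT.hasFDerivAt.clm_apply (hasFDerivAt_const v y)
    have h2 := h1.clm_apply (hasFDerivAt_const w y)
    rw [h2.fderiv]
    simp
  have hG1 := hd.hasFDerivAt.clm_apply (hasFDerivAt_const v y)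
  have hG2 := hG1.clm_apply (hasFDerivAt_const w y)
  have hv := hθ.hasFDerivAt.clm_apply (hasFDerivAt_const v y)
  have hw := hθ.hasFDerivAt.clm_apply (hasFDerivAt_const w y)
  have hsum := hG2.add (ha.mul (hv.mul hw))
  rw [← key]
  have hfun : (fun y' ↦ localTwist G a N y' v w) =
      fun y' ↦ G y' v w + a y' * (G y' (N y') v * G y' (N y') w) := by
    funext y'
    exact localTwist_apply v w
  rw [hfun]
  refine (congrArg (fun L : E →L[ℝ] ℝ ↦ L u) hsum.fderiv).trans ?_
  simp
  ring

/-- How the Levi-Civita connection changes under twisting, when `G(N, ·)` is closed and `N` is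
null; `w` is the gradient of `a` for the twisted metric. -/
lemma localChristoffel_localTwist (hG : (G y).IsInvertible)
    (hGt : (localTwist G a N y).IsInvertible) (hd : DifferentiableAt ℝ G y)
    (hs : ∀ᶠ y' in 𝓝 y, ∀ u v, G y' u v = G y' v u)
    (hN : HasFDerivAt N N' y) (ha : HasFDerivAt a a' y) (hnull : G y (N y) (N y) = 0)
    (hclosed : ∀ u v, fderiv ℝ (fun y' ↦ G y' (N y')) y u v =
      fderiv ℝ (fun y' ↦ G y' (N y')) y v u)
    {w : E} (hw : ∀ z, localTwist G a N y w z = a' z) (u v : E) :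
    localChristoffel (localTwist G a N) y u v = localChristoffel G y u v
      + (1 / 2 * (a' u * G y (N y) v + a' v * G y (N y) u)
          + a y * G y (N' u + localChristoffel G y u (N y)) v) • N y
      - (1 / 2 * (G y (N y) u * G y (N y) v)) • w := by
  apply hGt.injective
  ext z
  rw [localChristoffel_apply hGt]
  simp only [map_add, map_sub, map_smul, add_apply, sub_apply, smul_apply, smul_eq_mul, hw]
  simp only [fderiv_localTwist hd hN ha]
  simp only [localTwist_apply, localChristoffel_apply hG, hnull]
  have hs' := hs.self_of_nhds
  have h3 := fderiv_symm hd hs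
  have hΓ : G y (N y) (localChristoffel G y u v) =
      1 / 2 * (fderiv ℝ G y u v (N y) + fderiv ℝ G y v u (N y) - fderiv ℝ G y (N y) u v) := by
    rw [hs', localChristoffel_apply hG]
  have hD : ∀ p q, fderiv ℝ (fun y' ↦ G y' (N y')) y p q =
      G y (N' p) q + fderiv ℝ G y p (N y) q := by
    intro p q
    rw [(hd.hasFDerivAt.clm_apply hN).fderiv]
    simp
  rw [hΓ, hclosed z u, hclosed z v, hclosed v u, hD u v, h3 u v (N y), h3 v u (N y)]
  ring

/-- The Weingarten formula for the twisted metric in coordinates: along a null hypersurface `X`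
with rigged field `Z` and conformal screen, the covariant derivative of
`√|a| N - (sign a / √|a|) Z` is proportional to `Z`. Here `s` and `r` stand for `sign a` and
`√|a|` at the given point, `Z` is the image of `ζ`, and `hδ` is the derivative of the field `δ`;
`hda` expresses that `a` is constant along the screen distribution, and `hconf` that the screen is
conformal with factor `1 / a`. -/
lemma covDeriv_localTwist {X Z δ : F → E} {Z' δ' : F →L[ℝ] E} {z ζ : F} {r s : ℝ}
    (hG : (G (X z)).IsInvertible) (hGt : (localTwist G a N (X z)).IsInvertible)
    (hd : DifferentiableAt ℝ G (X z))
    (hs : ∀ᶠ y' in 𝓝 (X z), ∀ u v, G y' u v = G y' v u)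
    (hN : HasFDerivAt N N' (X z)) (ha : HasFDerivAt a a' (X z))
    (hnull : ∀ᶠ y' in 𝓝 (X z), G y' (N y') (N y') = 0)
    (hclosed : ∀ u v, fderiv ℝ (fun y' ↦ G y' (N y')) (X z) u v =
      fderiv ℝ (fun y' ↦ G y' (N y')) (X z) v u)
    (hX : ContDiffAt ℝ 2 X z) (hZ : HasFDerivAt Z Z' z)
    (hn : ∀ᶠ z' in 𝓝 z, ∀ e, G (X z') (Z z') (fderiv ℝ X z' e) = 0)
    (hZZ : ∀ᶠ z' in 𝓝 z, G (X z') (Z z') (Z z') = 0)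
    (hNZ : G (X z) (N (X z)) (Z z) = 1)
    (hζ : Z z = fderiv ℝ X z ζ)
    (hspan : ∀ w : E, ∃ (e : F) (c : ℝ), w = fderiv ℝ X z e + c • N (X z))
    (hr : r ≠ 0) (hss : s * s = 1) (hars : a (X z) = s * (r * r))
    (hδz : δ z = r • N (X z) - (s / r) • Z z)
    (hδ : ∀ e, δ' e = (s * a' (fderiv ℝ X z e) / (2 * r)) • N (X z) + r • N' (fderiv ℝ X z e)
      + (a' (fderiv ℝ X z e) / (2 * r ^ 3)) • Z z - (s / r) • Z' e)
    (hda : ∀ e, G (X z) (N (X z)) (fderiv ℝ X z e) = 0 → a' (fderiv ℝ X z e) = 0)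
    (hconf : ∀ e,
      -((N' (fderiv ℝ X z e) + localChristoffel G (X z) (fderiv ℝ X z e) (N (X z)))
        - G (X z) (N' (fderiv ℝ X z e) + localChristoffel G (X z) (fderiv ℝ X z e) (N (X z)))
          (Z z) • N (X z)) =
      (1 / a (X z)) • (-((Z' e + localChristoffel G (X z) (fderiv ℝ X z e) (Z z))
        - G (X z) (Z' e + localChristoffel G (X z) (fderiv ℝ X z e) (Z z)) (Z z) • N (X z))
        - G (X z) (N' (fderiv ℝ X z e) + localChristoffel G (X z) (fderiv ℝ X z e) (N (X z)))
          (Z z) • Z z)) (e : F) :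
    δ' e + localChristoffel (localTwist G a N) (X z) (fderiv ℝ X z e) (δ z) =
      (G (X z) (N (X z)) (fderiv ℝ X z e) * (s / (2 * r) *
        (2 * G (X z) (N' (Z z) + localChristoffel G (X z) (Z z) (N (X z))) (Z z)
          + a' (Z z) / a (X z) + a' (N (X z))))) • Z z := by
  have hX1 : HasFDerivAt X (fderiv ℝ X z) z := (hX.differentiableAt (by norm_num)).hasFDerivAt
  have hs' := hs.self_of_nhds
  have hsne : s ≠ 0 := fun h ↦ by simp [h] at hss
  have hane : a (X z) ≠ 0 := by rw [hars]; positivity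
  have hNN := hnull.self_of_nhds
  have hn' := hn.self_of_nhds
  have hZZ' := hZZ.self_of_nhds
  have hZN : G (X z) (Z z) (N (X z)) = 1 := by rw [hs', hNZ]
  -- `∇N` is orthogonal to `N`, and `∇Z` is orthogonal to `Z`
  have hDN : ∀ u, G (X z) (N' u + localChristoffel G (X z) u (N (X z))) (N (X z)) = 0 := by
    intro u
    have := metric_add_metric_eq_zero (X := id) (V := N) (W := N) (z := X z) hG hd hs
      (hasFDerivAt_id _) hN hN hnull u
    rw [id, hs' (N (X z))] at this
    simp only [ContinuousLinearMap.id_apply] at this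
    linarith
  have hDZ : ∀ e, G (X z) (Z' e + localChristoffel G (X z) (fderiv ℝ X z e) (Z z)) (Z z) = 0 := by
    intro e
    have := metric_add_metric_eq_zero hG hd hs hX1 hZ hZ hZZ e
    rw [hs' (Z z)] at this
    linarith
  have hB := covDeriv_normal_symm hG hd hs hX hZ hn
  have hH := covDeriv_symm_of_closed hG hd hs hN hclosed
  set y := X z with hy
  set P := fderiv ℝ X z with hP
  -- conformality solved for `∇Z`
  have hDZe : ∀ e, Z' e + localChristoffel G y (P e) (Z z) =
      a y • (N' (P e) + localChristoffel G y (P e) (N y))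
        - (a y * G y (N' (P e) + localChristoffel G y (P e) (N y)) (Z z)) • N y
        - G y (N' (P e) + localChristoffel G y (P e) (N y)) (Z z) • Z z := by
    intro e
    have h := congrArg (fun w ↦ a y • w) (hconf e)
    simp only [hDZ e, zero_smul, sub_zero, smul_smul, mul_one_div_cancel hane, one_smul] at h
    rw [smul_neg, smul_sub, smul_smul] at h
    linear_combination (norm := module) h
  -- the rotation form is proportional to `G(N, ·)`: insert `Z` into the conformality relation, and
  -- use that the shape operator and `∇N` are symmetric
  have hτ : ∀ e, G y (N' (P e) + localChristoffel G y (P e) (N y)) (Z z) =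
      G y (N y) (P e) * G y (N' (Z z) + localChristoffel G y (Z z) (N y)) (Z z) := by
    intro e
    have h1 := congrArg (fun w ↦ G y w (P e)) (hDZe ζ)
    have h2 := hB ζ e
    rw [← hζ] at h1 h2
    rw [hDZ e] at h2
    rw [h2] at h1
    simp only [map_sub, map_smul, sub_apply, smul_apply, smul_eq_mul, hn'] at h1
    rw [hH (P e) (Z z)]
    have h3 : a y * (G y (N' (Z z) + localChristoffel G y (Z z) (N y)) (P e)
        - G y (N y) (P e) * G y (N' (Z z) + localChristoffel G y (Z z) (N y)) (Z z)) = 0 := by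
      linear_combination -h1
    linarith [(mul_eq_zero.mp h3).resolve_left hane]
  -- with `θ = G(N, ·)`, the vector `P e - θ(P e) Z` lies in the screen distribution
  have hdae : ∀ e, a' (P e) = G y (N y) (P e) * a' (Z z) := by
    intro e
    have h1 := hda (e - G y (N y) (P e) • ζ) (by
      rw [map_sub, map_smul, ← hζ, map_sub, map_smul, hNZ]; simp)
    rw [map_sub, map_smul, ← hζ, map_sub, map_smul, smul_eq_mul] at h1
    linarith
  -- the gradient of `a` for the twisted metric, found from `G_a(N, ·) = θ` and
  -- `G_a(Z, ·) = G(Z, ·) + a θ`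
  have hw : ∀ w, localTwist G a N y (a' (N y) • Z z + (a' (Z z) - a y * a' (N y)) • N y) w =
      a' w := by
    intro w
    obtain ⟨e, c, rfl⟩ := hspan w
    simp only [localTwist_apply, map_add, map_smul, add_apply, smul_apply, smul_eq_mul, hNN, hNZ,
      hZN, hn', hdae]
    ring
  rw [hδz, localChristoffel_sub_smul, hδ,
    localChristoffel_localTwist hG hGt hd hs hN ha hNN hclosed hw,
    localChristoffel_localTwist hG hGt hd hs hN ha hNN hclosed hw, hDN, hNN, hNZ, hτ, hdae e]
  have hZe : Z' e = a y • (N' (P e) + localChristoffel G y (P e) (N y))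
        - (a y * (G y (N y) (P e) *
            G y (N' (Z z) + localChristoffel G y (Z z) (N y)) (Z z))) • N y
        - (G y (N y) (P e) * G y (N' (Z z) + localChristoffel G y (Z z) (N y)) (Z z)) • Z z
        - localChristoffel G y (P e) (Z z) := by
    rw [← hτ, ← hDZe]
    abel
  rw [hZe]
  generalize G y (N' (Z z) + localChristoffel G y (Z z) (N y)) (Z z) = τ
  rw [hars]
  match_scalars <;> field_simp <;> grobner

end LocalTwist

/-! ### Components of tensor fields and of maps in preferred charts -/

section Charts

variable {m : ℕ} {M : Type*} [TopologicalSpace M] [ChartedSpace (EuclideanSpace ℝ (Fin m)) M]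
  [IsManifold (𝓡 m) ∞ M]

/-- The components of the field of bilinear forms `g` at `q`, in the preferred chart at `p`. -/
def bilinAt (g : BilinField m M) (p q : M) :
    EuclideanSpace ℝ (Fin m) →L[ℝ] EuclideanSpace ℝ (Fin m) →L[ℝ] ℝ :=
  let e := (trivializationAt (EuclideanSpace ℝ (Fin m)) (TangentSpace (𝓡 m)) p).symmL ℝ q
  (ContinuousLinearMap.precomp ℝ e).comp ((g q).comp e)

/-- The components of the tangent vector `v` at `q`, in the preferred chart at `p`. -/
def vecAt (p q : M) : TangentSpace (𝓡 m) q →L[ℝ] EuclideanSpace ℝ (Fin m) :=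
  (trivializationAt (EuclideanSpace ℝ (Fin m)) (TangentSpace (𝓡 m)) p).continuousLinearMapAt ℝ q

/-- The tangent vector at `q` with given components in the preferred chart at `p`. -/
def frameAt (p q : M) : EuclideanSpace ℝ (Fin m) →L[ℝ] TangentSpace (𝓡 m) q :=
  (trivializationAt (EuclideanSpace ℝ (Fin m)) (TangentSpace (𝓡 m)) p).symmL ℝ q

lemma frameAt_vecAt {p q : M} (hq : q ∈ (extChartAt (𝓡 m) p).source)
    (v : TangentSpace (𝓡 m) q) : frameAt p q (vecAt p q v) = v :=
  Trivialization.symmL_continuousLinearMapAt _ (by simpa using hq) v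

lemma vecAt_frameAt {p q : M} (hq : q ∈ (extChartAt (𝓡 m) p).source)
    (v : EuclideanSpace ℝ (Fin m)) : vecAt p q (frameAt p q v) = v :=
  Trivialization.continuousLinearMapAt_symmL _ (by simpa using hq) v

lemma vecAt_self (p : M) (v : TangentSpace (𝓡 m) p) : vecAt p p v = v := by
  rw [vecAt, TangentBundle.continuousLinearMapAt_trivializationAt_eq_core (by simp)]
  exact (tangentBundleCore (𝓡 m) M).coordChange_self (achart _ p) p (mem_chart_source _ p) v

lemma frameAt_self (p : M) (v : EuclideanSpace ℝ (Fin m)) : frameAt p p v = v := by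
  rw [← vecAt_self p (frameAt p p v), vecAt_frameAt (by simp)]

lemma bilinAt_apply (g : BilinField m M) (p q : M) (u v : EuclideanSpace ℝ (Fin m)) :
    bilinAt g p q u v = g q (frameAt p q u) (frameAt p q v) := rfl

lemma bilinAt_vecAt (g : BilinField m M) {p q : M} (hq : q ∈ (extChartAt (𝓡 m) p).source)
    (u v : TangentSpace (𝓡 m) q) : bilinAt g p q (vecAt p q u) (vecAt p q v) = g q u v := by
  rw [bilinAt_apply, frameAt_vecAt hq, frameAt_vecAt hq]

lemma bilinInChart_eq (g : BilinField m M) (p : M) (y : EuclideanSpace ℝ (Fin m)) :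
    bilinInChart g p y = bilinAt g p ((extChartAt (𝓡 m) p).symm y) := rfl

lemma bilinInChart_self (g : BilinField m M) (p : M) :
    bilinInChart g p (extChartAt (𝓡 m) p p) = g p := by
  rw [bilinInChart_eq, extChartAt_to_inv]
  ext u v
  rw [bilinAt_apply, frameAt_self, frameAt_self]
  rfl

lemma oneFormInChart_apply (θ : OneForm m M) (p : M) (y u : EuclideanSpace ℝ (Fin m)) :
    oneFormInChart θ p y u =
      θ ((extChartAt (𝓡 m) p).symm y) (frameAt p ((extChartAt (𝓡 m) p).symm y) u) := rfl

lemma chart_symm_mem (p : M) :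
    ∀ᶠ y in 𝓝 (extChartAt (𝓡 m) p p),
      (extChartAt (𝓡 m) p).symm y ∈ (extChartAt (𝓡 m) p).source := by
  filter_upwards [extChartAt_target_mem_nhds (I := 𝓡 m) p] with y hy
  exact (extChartAt (𝓡 m) p).map_target hy

lemma contMDiffAt_iff_chart {G : Type*} [NormedAddCommGroup G] [NormedSpace ℝ G] {h : M → G}
    {p : M} {k : ℕ∞ω} : ContMDiffAt (𝓡 m) 𝓘(ℝ, G) k h p ↔
      ContDiffAt ℝ k (h ∘ (extChartAt (𝓡 m) p).symm) (extChartAt (𝓡 m) p p) := by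
  rw [contMDiffAt_iff_source, ModelWithCorners.range_eq_univ, contMDiffWithinAt_univ,
    contMDiffAt_iff_contDiffAt]

lemma mvfderiv_eq_fderiv {G : Type*} [NormedAddCommGroup G] [NormedSpace ℝ G] {h : M → G}
    {p : M} (hh : MDifferentiableAt (𝓡 m) 𝓘(ℝ, G) h p) (v : TangentSpace (𝓡 m) p) :
    mvfderiv (𝓡 m) h p v =
      fderiv ℝ (h ∘ (extChartAt (𝓡 m) p).symm) (extChartAt (𝓡 m) p p) v := by
  rw [mvfderiv, hh.mfderiv, ModelWithCorners.range_eq_univ, fderivWithin_univ]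
  rfl

/-- Smoothness of a field of bilinear forms is smoothness of its components. -/
lemma contMDiffAt_bilin_iff (g : BilinField m M) (p : M) : ContMDiffAt (𝓡 m)
    ((𝓡 m).prod 𝓘(ℝ, EuclideanSpace ℝ (Fin m) →L[ℝ] EuclideanSpace ℝ (Fin m) →L[ℝ] ℝ)) ∞
    (fun p ↦ TotalSpace.mk' (EuclideanSpace ℝ (Fin m) →L[ℝ] EuclideanSpace ℝ (Fin m) →L[ℝ] ℝ)
      (E := fun p : M ↦ TangentSpace (𝓡 m) p →L[ℝ] TangentSpace (𝓡 m) p →L[ℝ] ℝ) p (g p)) p ↔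
      ContDiffAt ℝ ∞ (bilinInChart g p) (extChartAt (𝓡 m) p p) := by
  rw [contMDiffAt_hom_bundle]
  refine (and_iff_right contMDiffAt_id).trans (Iff.trans ?_
    (contMDiffAt_iff_chart (h := bilinAt g p)))
  refine Filter.EventuallyEq.contMDiffAt_iff ?_
  filter_upwards [extChartAt_source_mem_nhds (I := 𝓡 m) p] with q hq
  have hq' : q ∈ (chartAt (EuclideanSpace ℝ (Fin m)) p).source := by simpa using hq
  ext u v
  simp only [ContinuousLinearMap.inCoordinates]
  rw [ContinuousLinearMap.comp_apply, Trivialization.continuousLinearMapAt_apply,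
    Trivialization.coe_linearMapAt_of_mem _ (by simpa [hom_trivializationAt_baseSet] using hq')]
  dsimp only
  rw [hom_trivializationAt_apply]
  simp [ContinuousLinearMap.inCoordinates]
  rfl

/-- Smoothness of a vector field along a map is smoothness of its components. -/
lemma contMDiffAt_vec_iff {k : ℕ} {N : Type*} [TopologicalSpace N]
    [ChartedSpace (EuclideanSpace ℝ (Fin k)) N] {f : N → M}
    {V : ∀ q : N, TangentSpace (𝓡 m) (f q)} {q : N} (hf : ContMDiffAt (𝓡 k) (𝓡 m) ∞ f q) :
    ContMDiffAt (𝓡 k) (𝓡 m).tangent ∞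
      (fun q ↦ (⟨f q, V q⟩ : TangentBundle (𝓡 m) M)) q ↔
      ContMDiffAt (𝓡 k) 𝓘(ℝ, EuclideanSpace ℝ (Fin m)) ∞ (fun r ↦ vecAt (f q) (f r) (V r)) q := by
  refine contMDiffAt_totalSpace.trans ((and_iff_right hf).trans ?_)
  refine Filter.EventuallyEq.contMDiffAt_iff ?_
  filter_upwards [hf.continuousAt (extChartAt_source_mem_nhds (I := 𝓡 m) (f q))] with r hr
  have hr' : f r ∈ (trivializationAt (EuclideanSpace ℝ (Fin m)) (TangentSpace (𝓡 m))
    (f q)).baseSet := by simpa using hr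
  simp only [vecAt, Trivialization.continuousLinearMapAt_apply,
    Trivialization.coe_linearMapAt_of_mem _ hr']

end Charts

section Maps

variable {m k : ℕ} {M : Type*} [TopologicalSpace M] [ChartedSpace (EuclideanSpace ℝ (Fin m)) M]
  [IsManifold (𝓡 m) ∞ M] {N : Type*} [TopologicalSpace N]
  [ChartedSpace (EuclideanSpace ℝ (Fin k)) N] [IsManifold (𝓡 k) ∞ N] {f : N → M}

/-- The map `f` in the preferred charts at `p` and `f p`. -/
def mapInChart (f : N → M) (p : N) (z : EuclideanSpace ℝ (Fin k)) : EuclideanSpace ℝ (Fin m) :=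
  extChartAt (𝓡 m) (f p) (f ((extChartAt (𝓡 k) p).symm z))

lemma mapInChart_self (f : N → M) (p : N) :
    mapInChart (m := m) f p (extChartAt (𝓡 k) p p) = extChartAt (𝓡 m) (f p) (f p) := by
  rw [mapInChart, extChartAt_to_inv]

lemma contDiffAt_mapInChart {p : N} (hf : ContMDiffAt (𝓡 k) (𝓡 m) ∞ f p) :
    ContDiffAt ℝ ∞ (mapInChart (m := m) f p) (extChartAt (𝓡 k) p p) := by
  have := (contMDiffAt_iff.mp hf).2
  rwa [ModelWithCorners.range_eq_univ, contDiffWithinAt_univ] at this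

lemma map_symm_mem {p : N} (hf : ContinuousAt f p) :
    ∀ᶠ z in 𝓝 (extChartAt (𝓡 k) p p),
      f ((extChartAt (𝓡 k) p).symm z) ∈ (extChartAt (𝓡 m) (f p)).source := by
  have h : ContinuousAt (extChartAt (𝓡 k) p).symm (extChartAt (𝓡 k) p p) :=
    continuousAt_extChartAt_symm p
  have h' : Tendsto (fun z ↦ f ((extChartAt (𝓡 k) p).symm z)) (𝓝 (extChartAt (𝓡 k) p p))
      (𝓝 (f p)) := by
    have := hf.tendsto.comp (f := (extChartAt (𝓡 k) p).symm) (x := 𝓝 (extChartAt (𝓡 k) p p))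
      (by simpa using h.tendsto)
    exact this
  exact h' (extChartAt_source_mem_nhds (I := 𝓡 m) (f p))

lemma symm_mapInChart {p : N} {z : EuclideanSpace ℝ (Fin k)}
    (hz : f ((extChartAt (𝓡 k) p).symm z) ∈ (extChartAt (𝓡 m) (f p)).source) :
    (extChartAt (𝓡 m) (f p)).symm (mapInChart f p z) = f ((extChartAt (𝓡 k) p).symm z) :=
  (extChartAt (𝓡 m) (f p)).left_inv hz

/-- The differential of `f` in the preferred charts. -/
lemma vecAt_mfderiv_frameAt {p q : N} (hf : MDifferentiableAt (𝓡 k) (𝓡 m) f q)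
    (hq : q ∈ (extChartAt (𝓡 k) p).source) (hfq : f q ∈ (extChartAt (𝓡 m) (f p)).source)
    (e : EuclideanSpace ℝ (Fin k)) :
    vecAt (f p) (f q) (mfderiv (𝓡 k) (𝓡 m) f q (frameAt p q e)) =
      fderiv ℝ (mapInChart (m := m) f p) (extChartAt (𝓡 k) p q) e := by
  set z := extChartAt (𝓡 k) p q with hz
  have hzq : (extChartAt (𝓡 k) p).symm z = q := (extChartAt (𝓡 k) p).left_inv hq
  have h1 : MDifferentiableAt (𝓡 m) 𝓘(ℝ, EuclideanSpace ℝ (Fin m)) (extChartAt (𝓡 m) (f p))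
      (f q) := mdifferentiableAt_extChartAt (by simpa using hfq)
  have h2 : MDifferentiableAt 𝓘(ℝ, EuclideanSpace ℝ (Fin k)) (𝓡 k) (extChartAt (𝓡 k) p).symm
      z := by
    have := mdifferentiableWithinAt_extChartAt_symm (I := 𝓡 k) (x := p)
      ((extChartAt (𝓡 k) p).map_source hq)
    rw [ModelWithCorners.range_eq_univ] at this
    exact mdifferentiableWithinAt_univ.1 this
  have h3 : mfderiv 𝓘(ℝ, EuclideanSpace ℝ (Fin k)) 𝓘(ℝ, EuclideanSpace ℝ (Fin m))
      ((extChartAt (𝓡 m) (f p) ∘ f) ∘ (extChartAt (𝓡 k) p).symm) z e =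
      mfderiv (𝓡 k) 𝓘(ℝ, EuclideanSpace ℝ (Fin m)) (extChartAt (𝓡 m) (f p) ∘ f)
        ((extChartAt (𝓡 k) p).symm z)
        (mfderiv 𝓘(ℝ, EuclideanSpace ℝ (Fin k)) (𝓡 k) (extChartAt (𝓡 k) p).symm z e) :=
    mfderiv_comp_apply z (by rw [hzq]; exact h1.comp q hf) h2 e
  have aux : ∀ q', q' = q → ∀ w : EuclideanSpace ℝ (Fin k),
      (mfderiv (𝓡 k) 𝓘(ℝ, EuclideanSpace ℝ (Fin m)) (extChartAt (𝓡 m) (f p) ∘ f) q' w :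
        EuclideanSpace ℝ (Fin m)) = vecAt (f p) (f q) (mfderiv (𝓡 k) (𝓡 m) f q w) := by
    rintro _ rfl w
    rw [vecAt, TangentBundle.continuousLinearMapAt_trivializationAt (by simpa using hfq)]
    exact mfderiv_comp_apply _ h1 hf w
  have h4 : frameAt p q e =
      mfderiv 𝓘(ℝ, EuclideanSpace ℝ (Fin k)) (𝓡 k) (extChartAt (𝓡 k) p).symm z e := by
    rw [frameAt, TangentBundle.symmL_trivializationAt (by simpa using hq),
      ModelWithCorners.range_eq_univ, mfderivWithin_univ]
    rfl
  rw [h4]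
  refine (aux _ hzq _).symm.trans (h3.symm.trans ?_)
  rw [mfderiv_eq_fderiv]
  rfl

end Maps

/-! ### Linear algebra of a rigged null hypersurface -/

lemma isInvertible_of_nondegenerate {E : Type*} [NormedAddCommGroup E] [NormedSpace ℝ E]
    [FiniteDimensional ℝ E] {B : E →L[ℝ] E →L[ℝ] ℝ} (hB : ∀ u, (∀ v, B u v = 0) → u = 0) :
    B.IsInvertible := by
  have hinj : Function.Injective B.toLinearMap := by
    rw [← LinearMap.ker_eq_bot, LinearMap.ker_eq_bot']
    intro u hu
    exact hB u fun v ↦ by simpa using congrArg (fun f : E →L[ℝ] ℝ ↦ f v) hu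
  have hdim : Module.finrank ℝ E = Module.finrank ℝ (E →L[ℝ] ℝ) := by
    rw [← (LinearMap.toContinuousLinearMap (𝕜 := ℝ) (E := E) (F' := ℝ)).finrank_eq]
    exact Subspace.dual_finrank_eq.symm
  refine ⟨(LinearEquiv.ofInjectiveOfFinrankEq B.toLinearMap hinj hdim).toContinuousLinearEquiv, ?_⟩
  ext
  rfl

/-- A hyperplane and a vector outside of it span. -/
lemma exists_eq_add_smul {E F : Type*} [AddCommGroup E] [Module ℝ E] [FiniteDimensional ℝ E]
    [AddCommGroup F] [Module ℝ F] [FiniteDimensional ℝ F]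
    (hdim : Module.finrank ℝ E = Module.finrank ℝ F + 1)
    {D : F →ₗ[ℝ] E} (hD : Function.Injective D) {N : E} (hN : N ∉ Set.range D) (w : E) :
    ∃ (e : F) (c : ℝ), w = D e + c • N := by
  have hlt : LinearMap.range D < LinearMap.range D ⊔ Submodule.span ℝ {N} := by
    refine lt_of_le_of_ne le_sup_left fun h ↦ hN ?_
    have : N ∈ LinearMap.range D := by
      rw [h]
      exact Submodule.mem_sup_right (Submodule.mem_span_singleton_self N)
    simpa using this
  have h1 := Submodule.finrank_lt_finrank_of_lt hlt
  rw [LinearMap.finrank_range_of_inj hD] at h1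
  have htop : LinearMap.range D ⊔ Submodule.span ℝ {N} = ⊤ :=
    Submodule.eq_top_of_finrank_eq (le_antisymm (Submodule.finrank_le _) (by omega))
  have hw : w ∈ LinearMap.range D ⊔ Submodule.span ℝ {N} := htop ▸ Submodule.mem_top
  obtain ⟨_, ⟨e, rfl⟩, _, hc, rfl⟩ := Submodule.mem_sup.mp hw
  obtain ⟨c, rfl⟩ := Submodule.mem_span_singleton.mp hc
  exact ⟨e, c, rfl⟩

lemma finiteDimensional_tangentSpace {m : ℕ} {M : Type*} [TopologicalSpace M]
    [ChartedSpace (EuclideanSpace ℝ (Fin m)) M] (p : M) :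
    FiniteDimensional ℝ (TangentSpace (𝓡 m) p) :=
  inferInstanceAs (FiniteDimensional ℝ (EuclideanSpace ℝ (Fin m)))

lemma finrank_tangentSpace {m : ℕ} {M : Type*} [TopologicalSpace M]
    [ChartedSpace (EuclideanSpace ℝ (Fin m)) M] (p : M) :
    Module.finrank ℝ (TangentSpace (𝓡 m) p) = m :=
  finrank_euclideanSpace_fin

section Immersion

variable {k m : ℕ} {M : Type*} [TopologicalSpace M] [ChartedSpace (EuclideanSpace ℝ (Fin k)) M]
  [IsManifold (𝓡 k) ∞ M] {Mb : Type*} [TopologicalSpace Mb]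
  [ChartedSpace (EuclideanSpace ℝ (Fin m)) Mb] [IsManifold (𝓡 m) ∞ Mb]

/-- The differential of an immersion is injective: in suitable charts the immersion has a smooth
left inverse. -/
lemma mfderiv_injective_of_isImmersionAt {x : M → Mb} {p : M}
    (h : Manifold.IsImmersionAt (𝓡 k) (𝓡 m) ∞ x p) :
    Function.Injective (mfderiv (𝓡 k) (𝓡 m) x p) := by
  let φ := h.domChart.extend (𝓡 k)
  let ψ := h.codChart.extend (𝓡 m)
  let L : Mb → M := φ.symm ∘ (fun w ↦ (h.equiv.symm w).1) ∘ ψ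
  have hp : p ∈ φ.source := by
    rw [OpenPartialHomeomorph.extend_source]; exact h.mem_domChart_source
  have hLx : ∀ᶠ q in 𝓝 p, L (x q) = q := by
    filter_upwards [h.domChart.open_source.mem_nhds h.mem_domChart_source] with q hq
    have hq' : q ∈ φ.source := by rwa [OpenPartialHomeomorph.extend_source]
    have h1 := h.writtenInCharts (φ.map_source hq')
    have h2 : ψ (x q) = h.equiv (φ q, 0) := by
      have h3 : φ.symm (φ q) = q := φ.left_inv hq'
      have h4 : ψ (x (φ.symm (φ q))) = h.equiv (φ q, 0) := h1
      rwa [h3] at h4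
    simp only [L, Function.comp_apply, h2, ContinuousLinearEquiv.symm_apply_apply]
    exact φ.left_inv hq'
  have hψ : MDifferentiableAt (𝓡 m) 𝓘(ℝ, EuclideanSpace ℝ (Fin m)) ψ (x p) :=
    (h.codChart.contMDiffAt_extend h.codChart_mem_maximalAtlas
      h.mem_codChart_source).mdifferentiableAt (by simp)
  have hmid : ((fun w ↦ (h.equiv.symm w).1) ∘ ψ) (x p) = φ p := by
    have h1 := h.writtenInCharts (φ.map_source hp)
    have h2 : ψ (x p) = h.equiv (φ p, 0) := by
      have h3 : φ.symm (φ p) = p := φ.left_inv hp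
      have h4 : ψ (x (φ.symm (φ p))) = h.equiv (φ p, 0) := h1
      rwa [h3] at h4
    simp only [Function.comp_apply, h2, ContinuousLinearEquiv.symm_apply_apply]
  have hφ : MDifferentiableAt 𝓘(ℝ, EuclideanSpace ℝ (Fin k)) (𝓡 k) φ.symm (φ p) :=
    ((contMDiffOn_extend_symm h.domChart_mem_maximalAtlas).contMDiffAt (by
      have := h.domChart.extend_image_target_mem_nhds (I := 𝓡 k) h.mem_domChart_source
      simpa [φ] using this)).mdifferentiableAt (by simp)
  have hlin : MDifferentiableAt 𝓘(ℝ, EuclideanSpace ℝ (Fin m)) 𝓘(ℝ, EuclideanSpace ℝ (Fin k))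
      (fun w ↦ (h.equiv.symm w).1) (ψ (x p)) := by
    apply DifferentiableAt.mdifferentiableAt
    exact (h.equiv.symm.differentiableAt).fst
  have hL : MDifferentiableAt (𝓡 m) (𝓡 k) L (x p) :=
    MDifferentiableAt.comp_of_eq (x p) hφ (hlin.comp (x p) hψ) hmid
  have hx : MDifferentiableAt (𝓡 k) (𝓡 m) x p := h.contMDiffAt.mdifferentiableAt (by simp)
  have hid : mfderiv (𝓡 k) (𝓡 k) (L ∘ x) p = mfderiv (𝓡 k) (𝓡 k) id p :=
    Filter.EventuallyEq.mfderiv_eq hLx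
  intro u v huv
  have hcomp : ∀ w, mfderiv (𝓡 k) (𝓡 k) (L ∘ x) p w = mfderiv (𝓡 m) (𝓡 k) L (x p)
    (mfderiv (𝓡 k) (𝓡 m) x p w) := fun w ↦ mfderiv_comp_apply p hL hx w
  have hu := hcomp u
  have hv := hcomp v
  rw [huv] at hu
  have huv' := hu.trans hv.symm
  rw [hid, mfderiv_id] at huv'
  exact huv'

end Immersion

section Hypersurface

variable {n : ℕ}
  {Mb : Type*} [TopologicalSpace Mb] [ChartedSpace (EuclideanSpace ℝ (Fin (n + 1))) Mb]
  [IsManifold (𝓡 (n + 1)) ∞ Mb]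
  {M : Type*} [TopologicalSpace M] [ChartedSpace (EuclideanSpace ℝ (Fin n)) M]
  [IsManifold (𝓡 n) ∞ M]

/-- `N` is a null rigging of the immersed null hypersurface `x` of the semi-Riemannian manifold
`(Mb, gb)`. Of `x` being an embedding only its smoothness and the injectivity of its differential
are recorded. -/
structure IsNullRigging (gb : BilinField (n + 1) Mb) (x : M → Mb) (N : VectorField (n + 1) Mb) :
    Prop where
  metric : IsSemiRiemannianMetric gb
  smooth_map : ContMDiff (𝓡 n) (𝓡 (n + 1)) ∞ x
  injective : ∀ p : M, Function.Injective (dx (n := n) x p)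
  nullHypersurface : IsNullHypersurface gb x
  smooth : ContMDiff (𝓡 (n + 1)) (𝓡 (n + 1)).tangent ∞
    (fun y ↦ (⟨y, N y⟩ : TangentBundle (𝓡 (n + 1)) Mb))
  null : ∀ y, gb y (N y) (N y) = 0
  transversal : ∀ p : M, N (x p) ∉ Set.range (dx x p)

variable {gb : BilinField (n + 1) Mb} {x : M → Mb} {N : VectorField (n + 1) Mb} {α : Mb → ℝ}

lemma mem_radical {p : M} {u : TangentSpace (𝓡 n) p} :
    u ∈ radical gb x p ↔ ∀ v, gb (x p) (dx x p u) (dx x p v) = 0 := by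
  rw [radical, LinearMap.mem_ker]
  exact ⟨fun h v ↦ congrArg (fun f : TangentSpace (𝓡 n) p →L[ℝ] ℝ ↦ f v) h,
    fun h ↦ ContinuousLinearMap.ext h⟩

lemma mem_screen {p : M} {u : TangentSpace (𝓡 n) p} :
    u ∈ screen gb x N p ↔ eta gb x N p u = 0 := Iff.rfl

lemma eta_apply (p : M) (u : TangentSpace (𝓡 n) p) :
    eta gb x N p u = gb (x p) (N (x p)) (dx x p u) := rfl

lemma twisted_apply (y : Mb) (u v : TangentSpace (𝓡 (n + 1)) y) :
    twisted gb N α y u v = gb y u v + α y * (gb y (N y) u * gb y (N y) v) := rfl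

lemma pullBilin_apply (g : BilinField (n + 1) Mb) (p : M) (u v : TangentSpace (𝓡 n) p) :
    pullBilin x g p u v = g (x p) (dx x p u) (dx x p v) := rfl

lemma pullBilin_twisted : pullBilin x (twisted gb N α) = associated gb x N α := rfl

/-- Twisting by a null field keeps the metric non-degenerate for any function `α`: pairing with
`N` first gives `gb(N, u) = 0`. -/
lemma twisted_nondegenerate (hgb : IsSemiRiemannianMetric gb) (hN : ∀ y, gb y (N y) (N y) = 0)
    (y : Mb) (u : TangentSpace (𝓡 (n + 1)) y) (hu : ∀ v, twisted gb N α y u v = 0) : u = 0 := by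
  have h1 : gb y (N y) u = 0 := by
    have := hu (N y)
    rw [twisted_apply, hN, hgb.symm] at this
    simpa using this
  refine hgb.nondegenerate y u fun v ↦ ?_
  have := hu v
  rw [twisted_apply, h1] at this
  simpa using this

namespace IsNullRigging

variable (h : IsNullRigging gb x N)
include h

lemma exists_eq_add_smul (p : M) (w : TangentSpace (𝓡 (n + 1)) (x p)) :
    ∃ (e : TangentSpace (𝓡 n) p) (c : ℝ), w = dx x p e + c • N (x p) :=
  have := finiteDimensional_tangentSpace (m := n) p
  have := finiteDimensional_tangentSpace (m := n + 1) (x p)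
  RiggedNull.exists_eq_add_smul (by rw [finrank_tangentSpace, finrank_tangentSpace])
    (D := (dx x p).toLinearMap) (h.injective p) (h.transversal p) w

/-- The radical and the screen distribution are disjoint, because `N` is transversal to the
hypersurface and `gb` is non-degenerate. -/
lemma eq_zero_of_mem_radical {p : M} {u : TangentSpace (𝓡 n) p} (hu : u ∈ radical gb x p)
    (hη : eta gb x N p u = 0) : u = 0 := by
  apply h.injective p
  rw [map_zero]
  refine h.metric.nondegenerate _ _ fun w ↦ ?_
  obtain ⟨e, c, rfl⟩ := h.exists_eq_add_smul p w
  rw [map_add, map_smul, mem_radical.mp hu, h.metric.symm, ← eta_apply, hη]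
  simp

lemma rigged_spec (p : M) :
    rigged gb x N p ∈ radical gb x p ∧ eta gb x N p (rigged gb x N p) = 1 := by
  obtain ⟨u, hu0, hu⟩ := h.nullHypersurface p
  have hη : eta gb x N p u ≠ 0 := fun h0 ↦ hu0 (h.eq_zero_of_mem_radical hu h0)
  exact Classical.epsilon_spec (p := fun u : TangentSpace (𝓡 n) p ↦
    u ∈ radical gb x p ∧ eta gb x N p u = 1)
    ⟨(eta gb x N p u)⁻¹ • u, Submodule.smul_mem _ _ hu, by simp [hη]⟩

lemma gb_riggedAlong (p : M) (v : TangentSpace (𝓡 n) p) :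
    gb (x p) (riggedAlong gb x N p) (dx x p v) = 0 := mem_radical.mp (h.rigged_spec p).1 v

lemma gb_riggedAlong_self (p : M) :
    gb (x p) (riggedAlong gb x N p) (riggedAlong gb x N p) = 0 := h.gb_riggedAlong p _

lemma gb_rigging_riggedAlong (p : M) : gb (x p) (N (x p)) (riggedAlong gb x N p) = 1 :=
  (h.rigged_spec p).2

lemma eq_smul_rigged {p : M} {u : TangentSpace (𝓡 n) p} (hu : u ∈ radical gb x p) :
    u = eta gb x N p u • rigged gb x N p := by
  rw [← sub_eq_zero]
  refine h.eq_zero_of_mem_radical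
    (Submodule.sub_mem _ hu (Submodule.smul_mem _ _ (h.rigged_spec p).1)) ?_
  rw [map_sub, map_smul, (h.rigged_spec p).2]
  simp

lemma rigged_ne_zero (p : M) : rigged gb x N p ≠ 0 := fun h0 ↦ by
  have := (h.rigged_spec p).2
  rw [h0, map_zero] at this
  exact zero_ne_one this

lemma finrank_radical (p : M) : Module.finrank ℝ (radical gb x p) = 1 := by
  rw [finrank_eq_one_iff']
  refine ⟨⟨rigged gb x N p, (h.rigged_spec p).1⟩, fun h0 ↦ h.rigged_ne_zero p ?_, fun u ↦
    ⟨eta gb x N p u, Subtype.ext (h.eq_smul_rigged u.2).symm⟩⟩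
  simpa using h0

lemma isCompl (p : M) : IsCompl (screen gb x N p) (radical gb x p) := by
  constructor
  · rw [Submodule.disjoint_def]
    exact fun u hu hu' ↦ h.eq_zero_of_mem_radical hu' hu
  · rw [codisjoint_iff, eq_top_iff]
    intro v _
    rw [← sub_add_cancel v (eta gb x N p v • rigged gb x N p)]
    refine Submodule.add_mem_sup ?_ (Submodule.smul_mem _ _ (h.rigged_spec p).1)
    rw [mem_screen, map_sub, map_smul, (h.rigged_spec p).2]
    simp

lemma finrank_screen (p : M) : Module.finrank ℝ (screen gb x N p) + 1 = n := by
  have := finiteDimensional_tangentSpace (m := n) p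
  have h1 := Submodule.finrank_add_eq_of_isCompl (h.isCompl p)
  rw [h.finrank_radical p] at h1
  rw [h1, finrank_tangentSpace]

lemma associated_rigged (p : M) (v : TangentSpace (𝓡 n) p) :
    associated gb x N α p (rigged gb x N p) v = α (x p) * eta gb x N p v := by
  have h1 := (h.rigged_spec p).2
  rw [eta_apply] at h1
  rw [← pullBilin_twisted, pullBilin_apply, twisted_apply, h1,
    mem_radical.mp (h.rigged_spec p).1, eta_apply]
  ring

lemma associated_symm (p : M) (u v : TangentSpace (𝓡 n) p) :
    associated gb x N α p u v = associated gb x N α p v u := by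
  rw [← pullBilin_twisted, pullBilin_apply, pullBilin_apply, twisted_apply, twisted_apply,
    h.metric.symm]
  ring

lemma associated_nondegenerate (hα : ∀ y, α y ≠ 0) (p : M) (u : TangentSpace (𝓡 n) p)
    (hu : ∀ v, associated gb x N α p u v = 0) : u = 0 := by
  have hη : eta gb x N p u = 0 := by
    have := hu (rigged gb x N p)
    rw [h.associated_symm, h.associated_rigged] at this
    exact (mul_eq_zero.mp this).resolve_left (hα _)
  refine h.eq_zero_of_mem_radical (mem_radical.mpr fun v ↦ ?_) hη
  have := hu v
  rw [← pullBilin_twisted, pullBilin_apply, twisted_apply, ← eta_apply, hη] at this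
  simpa using this

/-- A one-form on `M` vanishing on the screen distribution has gradient along the rigged field. -/
lemma eta_sharp (hα : ∀ y, α y ≠ 0) (θ : OneForm n M) (p : M)
    (hθ : ∀ v, eta gb x N p v = 0 → θ p v = 0) :
    eta gb x N p (sharp (associated gb x N α) θ p) = θ p (rigged gb x N p) / α (x p) := by
  have hinv : (associated gb x N α p).IsInvertible :=
    isInvertible_of_nondegenerate (E := EuclideanSpace ℝ (Fin n))
      (h.associated_nondegenerate hα p)
  have h1 : associated gb x N α p ((θ p (rigged gb x N p) / α (x p)) • rigged gb x N p) = θ p := by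
    ext v
    rw [map_smul]
    change θ p (rigged gb x N p) / α (x p) * associated gb x N α p (rigged gb x N p) v = θ p v
    rw [h.associated_rigged]
    have h2 := hθ (v - eta gb x N p v • rigged gb x N p) (by
      rw [map_sub, map_smul, (h.rigged_spec p).2]; simp)
    rw [map_sub, map_smul, smul_eq_mul] at h2
    have := hα (x p)
    field_simp
    linarith
  have h3 : sharp (associated gb x N α) θ p =
      (θ p (rigged gb x N p) / α (x p)) • rigged gb x N p := by
    have h4 : ∀ w, (associated gb x N α p).inverse (associated gb x N α p w) = w := by
      obtain ⟨e, he⟩ := hinv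
      intro w
      rw [← he, ContinuousLinearMap.inverse_equiv]
      exact e.symm_apply_apply w
    have h5 := h4 ((θ p (rigged gb x N p) / α (x p)) • rigged gb x N p)
    rwa [h1] at h5
  rw [h3, map_smul, (h.rigged_spec p).2]
  simp

end IsNullRigging

end Hypersurface

/-! ### Smoothness of the metrics and of the rigged field -/

lemma contDiffAt_localTwist {E : Type*} [NormedAddCommGroup E] [NormedSpace ℝ E]
    {G : E → E →L[ℝ] E →L[ℝ] ℝ} {a : E → ℝ} {N : E → E} {y : E} (hG : ContDiffAt ℝ ∞ G y)
    (ha : ContDiffAt ℝ ∞ a y) (hN : ContDiffAt ℝ ∞ N y) :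
    ContDiffAt ℝ ∞ (localTwist G a N) y := by
  have hθ : ContDiffAt ℝ ∞ (fun y' ↦ G y' (N y')) y := hG.clm_apply hN
  have h1 : ContDiffAt ℝ ∞ (fun y' ↦ ContinuousLinearMap.smulRightL ℝ E (E →L[ℝ] ℝ)
      (G y' (N y')) (G y' (N y'))) y :=
    ((ContinuousLinearMap.smulRightL ℝ E (E →L[ℝ] ℝ)).contDiff.contDiffAt.comp y hθ).clm_apply hθ
  exact hG.add (ha.smul h1)

/-- The bilinear form `B(D ·, D ·)`. -/
def localPull {E F : Type*} [NormedAddCommGroup E] [NormedSpace ℝ E] [NormedAddCommGroup F]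
    [NormedSpace ℝ F] (B : E →L[ℝ] E →L[ℝ] ℝ) (D : F →L[ℝ] E) : F →L[ℝ] F →L[ℝ] ℝ :=
  (ContinuousLinearMap.precomp ℝ D).comp (B.comp D)

lemma contDiffAt_localPull {E F : Type*} [NormedAddCommGroup E] [NormedSpace ℝ E]
    [NormedAddCommGroup F] [NormedSpace ℝ F] {B : F → E →L[ℝ] E →L[ℝ] ℝ} {D : F → F →L[ℝ] E}
    {z : F} (hB : ContDiffAt ℝ ∞ B z) (hD : ContDiffAt ℝ ∞ D z) :
    ContDiffAt ℝ ∞ (fun z' ↦ localPull (B z') (D z')) z := by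
  have h1 : ContDiffAt ℝ ∞ (fun z' ↦ (ContinuousLinearMap.compL ℝ F E ℝ).flip (D z')) z :=
    (ContinuousLinearMap.compL ℝ F E ℝ).flip.contDiff.contDiffAt.comp z hD
  exact h1.clm_comp (hB.clm_comp hD)

section Charts

variable {m : ℕ} {M : Type*} [TopologicalSpace M] [ChartedSpace (EuclideanSpace ℝ (Fin m)) M]
  [IsManifold (𝓡 m) ∞ M]

lemma bilinAt_isInvertible {g : BilinField m M} {p q : M}
    (hq : q ∈ (extChartAt (𝓡 m) p).source)
    (hg : ∀ u : TangentSpace (𝓡 m) q, (∀ v, g q u v = 0) → u = 0) :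
    (bilinAt g p q).IsInvertible := by
  refine isInvertible_of_nondegenerate fun u hu ↦ ?_
  have h1 : frameAt p q u = 0 := by
    refine hg _ fun v ↦ ?_
    rw [← frameAt_vecAt hq v]
    exact hu _
  rw [← vecAt_frameAt hq u, h1, map_zero]

/-- The components of the vector field `N` in the preferred chart at `p`. -/
def vecInChart (N : VectorField m M) (p : M) (y : EuclideanSpace ℝ (Fin m)) :
    EuclideanSpace ℝ (Fin m) :=
  vecAt p ((extChartAt (𝓡 m) p).symm y) (N ((extChartAt (𝓡 m) p).symm y))

lemma vecInChart_self (N : VectorField m M) (p : M) :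
    vecInChart N p (extChartAt (𝓡 m) p p) = N p := by
  have : ∀ q, q = p → (vecAt p q (N q) : EuclideanSpace ℝ (Fin m)) = N p := by
    rintro _ rfl
    exact vecAt_self _ _
  exact this _ (extChartAt_to_inv p)

lemma contDiffAt_vecInChart {N : VectorField m M} (hN : ContMDiff (𝓡 m) (𝓡 m).tangent ∞
    (fun y ↦ (⟨y, N y⟩ : TangentBundle (𝓡 m) M))) (p : M) :
    ContDiffAt ℝ ∞ (vecInChart N p) (extChartAt (𝓡 m) p p) :=
  contMDiffAt_iff_chart.mp ((contMDiffAt_vec_iff (f := id) (V := N) contMDiffAt_id).mp (hN p))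

lemma contDiffAt_bilinInChart {g : BilinField m M} (hg : IsSemiRiemannianMetric g) (p : M) :
    ContDiffAt ℝ ∞ (bilinInChart g p) (extChartAt (𝓡 m) p p) :=
  (contMDiffAt_bilin_iff g p).mp (hg.smooth p)

lemma contDiffAt_comp_symm {α : M → ℝ} (hα : ContMDiff (𝓡 m) 𝓘(ℝ, ℝ) ∞ α) (p : M) :
    ContDiffAt ℝ ∞ (α ∘ (extChartAt (𝓡 m) p).symm) (extChartAt (𝓡 m) p p) :=
  contMDiffAt_iff_chart.mp (hα p)

lemma bilinInChart_vecInChart (g : BilinField m M) (N : VectorField m M) {p : M}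
    {y : EuclideanSpace ℝ (Fin m)}
    (hy : (extChartAt (𝓡 m) p).symm y ∈ (extChartAt (𝓡 m) p).source) :
    bilinInChart g p y (vecInChart N p y) = oneFormInChart (flat g N) p y := by
  ext u
  rw [bilinInChart_eq, vecInChart, bilinAt_apply, frameAt_vecAt hy]
  rfl

lemma bilinInChart_symm {g : BilinField m M} (hg : IsSemiRiemannianMetric g) (p : M)
    (y u v : EuclideanSpace ℝ (Fin m)) : bilinInChart g p y u v = bilinInChart g p y v u :=
  hg.symm _ _ _

end Charts

section Hypersurface

variable {n : ℕ}
  {Mb : Type*} [TopologicalSpace Mb] [ChartedSpace (EuclideanSpace ℝ (Fin (n + 1))) Mb]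
  [IsManifold (𝓡 (n + 1)) ∞ Mb]
  {M : Type*} [TopologicalSpace M] [ChartedSpace (EuclideanSpace ℝ (Fin n)) M]
  [IsManifold (𝓡 n) ∞ M]
  {gb : BilinField (n + 1) Mb} {x : M → Mb} {N : VectorField (n + 1) Mb} {α : Mb → ℝ}

/-- In coordinates the twisted metric is the twisted metric of the coordinate space. -/
lemma bilinInChart_twisted {p y} (hy : (extChartAt (𝓡 (n + 1)) p).symm y ∈
      (extChartAt (𝓡 (n + 1)) p).source) :
    bilinInChart (twisted gb N α) p y =
      localTwist (bilinInChart gb p) (α ∘ (extChartAt (𝓡 (n + 1)) p).symm) (vecInChart N p) y := by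
  ext u v
  rw [localTwist_apply, bilinInChart_vecInChart _ _ hy]
  rfl

lemma isSemiRiemannianMetric_twisted (hgb : IsSemiRiemannianMetric gb)
    (hN : ContMDiff (𝓡 (n + 1)) (𝓡 (n + 1)).tangent ∞
      (fun y ↦ (⟨y, N y⟩ : TangentBundle (𝓡 (n + 1)) Mb)))
    (hnull : ∀ y, gb y (N y) (N y) = 0) (hα : ContMDiff (𝓡 (n + 1)) 𝓘(ℝ, ℝ) ∞ α) :
    IsSemiRiemannianMetric (twisted gb N α) where
  smooth p := by
    rw [contMDiffAt_bilin_iff]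
    refine (contDiffAt_localTwist (contDiffAt_bilinInChart hgb p) (contDiffAt_comp_symm hα p)
      (contDiffAt_vecInChart hN p)).congr_of_eventuallyEq ?_
    filter_upwards [chart_symm_mem p] with y hy
    exact bilinInChart_twisted hy
  symm p u v := by
    rw [twisted_apply, twisted_apply, hgb.symm]
    ring
  nondegenerate := twisted_nondegenerate hgb hnull

/-- The components of the pullback of a bilinear form. -/
lemma bilinInChart_pullBilin (hx : ContMDiff (𝓡 n) (𝓡 (n + 1)) ∞ x) (g : BilinField (n + 1) Mb)
    {p : M} {z : EuclideanSpace ℝ (Fin n)} (hz : z ∈ (extChartAt (𝓡 n) p).target)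
    (hxz : x ((extChartAt (𝓡 n) p).symm z) ∈ (extChartAt (𝓡 (n + 1)) (x p)).source) :
    bilinInChart (pullBilin x g) p z =
      localPull (bilinInChart g (x p) (mapInChart x p z)) (fderiv ℝ (mapInChart x p) z) := by
  have hq := (extChartAt (𝓡 n) p).map_target hz
  have hd := vecAt_mfderiv_frameAt ((hx _).mdifferentiableAt (by simp)) hq hxz
  rw [(extChartAt (𝓡 n) p).right_inv hz] at hd
  ext u v
  rw [bilinInChart_eq, bilinInChart_eq, bilinAt_apply, pullBilin_apply, symm_mapInChart hxz]
  change _ = bilinAt g (x p) (x ((extChartAt (𝓡 n) p).symm z)) (fderiv ℝ (mapInChart x p) z u)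
    (fderiv ℝ (mapInChart x p) z v)
  rw [← hd, ← hd, bilinAt_vecAt g hxz]

lemma eventually_mem_chart (hx : ContMDiff (𝓡 n) (𝓡 (n + 1)) ∞ x) (p : M) :
    ∀ᶠ z in 𝓝 (extChartAt (𝓡 n) p p), z ∈ (extChartAt (𝓡 n) p).target ∧
      x ((extChartAt (𝓡 n) p).symm z) ∈ (extChartAt (𝓡 (n + 1)) (x p)).source :=
  Filter.Eventually.and (extChartAt_target_mem_nhds (I := 𝓡 n) p)
    (map_symm_mem (hx p).continuousAt)

lemma contDiffAt_bilinInChart_pullBilin (hx : ContMDiff (𝓡 n) (𝓡 (n + 1)) ∞ x)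
    {g : BilinField (n + 1) Mb} (hg : IsSemiRiemannianMetric g) (p : M) :
    ContDiffAt ℝ ∞ (bilinInChart (pullBilin x g) p) (extChartAt (𝓡 n) p p) := by
  have h1 := contDiffAt_mapInChart (hx p)
  have h2 : ContDiffAt ℝ ∞ (fun z ↦ bilinInChart g (x p) (mapInChart x p z))
      (extChartAt (𝓡 n) p p) := by
    have := contDiffAt_bilinInChart hg (x p)
    rw [← mapInChart_self (m := n + 1) (k := n) x p] at this
    exact this.comp _ h1
  refine (contDiffAt_localPull h2 (h1.fderiv_right (m := ∞) (by simp))).congr_of_eventuallyEq ?_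
  filter_upwards [eventually_mem_chart hx p] with z hz
  exact bilinInChart_pullBilin hx g hz.1 hz.2

/-- The components of the one-form `η`. -/
lemma oneFormInChart_eta (hx : ContMDiff (𝓡 n) (𝓡 (n + 1)) ∞ x)
    {p : M} {z : EuclideanSpace ℝ (Fin n)} (hz : z ∈ (extChartAt (𝓡 n) p).target)
    (hxz : x ((extChartAt (𝓡 n) p).symm z) ∈ (extChartAt (𝓡 (n + 1)) (x p)).source) :
    oneFormInChart (eta gb x N) p z =
      (bilinInChart gb (x p) (mapInChart x p z) (vecInChart N (x p) (mapInChart x p z))).comp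
        (fderiv ℝ (mapInChart x p) z) := by
  have hq := (extChartAt (𝓡 n) p).map_target hz
  have hd := vecAt_mfderiv_frameAt ((hx _).mdifferentiableAt (by simp)) hq hxz
  rw [(extChartAt (𝓡 n) p).right_inv hz] at hd
  ext u
  rw [ContinuousLinearMap.comp_apply, oneFormInChart_apply, eta_apply, bilinInChart_eq,
    vecInChart, symm_mapInChart hxz, ← hd, bilinAt_vecAt gb hxz]

lemma contDiffAt_oneFormInChart_eta (h : IsNullRigging gb x N) (p : M) :
    ContDiffAt ℝ ∞ (oneFormInChart (eta gb x N) p) (extChartAt (𝓡 n) p p) := by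
  have h1 := contDiffAt_mapInChart (h.smooth_map p)
  have h2 := contDiffAt_bilinInChart h.metric (x p)
  have h3 := contDiffAt_vecInChart h.smooth (x p)
  rw [← mapInChart_self (m := n + 1) (k := n) x p] at h2 h3
  refine (((h2.comp _ h1).clm_apply (h3.comp _ h1)).clm_comp
    (h1.fderiv_right (m := ∞) (by simp))).congr_of_eventuallyEq ?_
  filter_upwards [eventually_mem_chart h.smooth_map p] with z hz
  exact oneFormInChart_eta h.smooth_map hz.1 hz.2

namespace IsNullRigging

variable (h : IsNullRigging gb x N)
include h

lemma isSemiRiemannianMetric_twisted (hα : ContMDiff (𝓡 (n + 1)) 𝓘(ℝ, ℝ) ∞ α) :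
    IsSemiRiemannianMetric (twisted gb N α) :=
  RiggedNull.isSemiRiemannianMetric_twisted h.metric h.smooth h.null hα

lemma isSemiRiemannianMetric_associated (hα : ContMDiff (𝓡 (n + 1)) 𝓘(ℝ, ℝ) ∞ α)
    (hα0 : ∀ y, α y ≠ 0) : IsSemiRiemannianMetric (associated gb x N α) where
  smooth p := by
    rw [contMDiffAt_bilin_iff, ← pullBilin_twisted]
    exact contDiffAt_bilinInChart_pullBilin h.smooth_map (h.isSemiRiemannianMetric_twisted hα) p
  symm := h.associated_symm
  nondegenerate := h.associated_nondegenerate hα0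

/-- The rigged field is smooth: it corresponds to `η` under the metric `g + η ⊗ η`. -/
lemma contDiffAt_rigged (p : M) :
    ContDiffAt ℝ ∞ (vecInChart (rigged gb x N) p) (extChartAt (𝓡 n) p p) := by
  have hm : IsSemiRiemannianMetric (associated gb x N fun _ ↦ 1) :=
    h.isSemiRiemannianMetric_associated contMDiff_const (fun _ ↦ one_ne_zero)
  have hinv : ∀ z, (extChartAt (𝓡 n) p).symm z ∈ (extChartAt (𝓡 n) p).source →
      (bilinInChart (associated gb x N fun _ ↦ 1) p z).IsInvertible := fun z hz ↦
    bilinAt_isInvertible hz (hm.nondegenerate _)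
  have hsm : ContDiffAt ℝ ∞ (fun z ↦ (bilinInChart (associated gb x N fun _ ↦ 1) p z).inverse
      (oneFormInChart (eta gb x N) p z)) (extChartAt (𝓡 n) p p) := by
    obtain ⟨e, he⟩ := hinv (extChartAt (𝓡 n) p p) (by simp)
    refine ContDiffAt.clm_apply ?_ (contDiffAt_oneFormInChart_eta h p)
    have h1 : ContDiffAt ℝ ∞ ContinuousLinearMap.inverse
        (bilinInChart (associated gb x N fun _ ↦ 1) p (extChartAt (𝓡 n) p p)) := by
      rw [← he]
      exact contDiffAt_map_inverse e
    exact h1.comp _ (contDiffAt_bilinInChart hm p)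
  refine hsm.congr_of_eventuallyEq ?_
  filter_upwards [chart_symm_mem p] with z hz
  have h1 : bilinInChart (associated gb x N fun _ ↦ 1) p z (vecInChart (rigged gb x N) p z) =
      oneFormInChart (eta gb x N) p z := by
    rw [bilinInChart_vecInChart _ _ hz]
    ext u
    rw [oneFormInChart_apply, oneFormInChart_apply, flat, h.associated_rigged, one_mul]
  obtain ⟨e, he⟩ := hinv z hz
  rw [← h1, ← he, ContinuousLinearMap.inverse_equiv]
  simp

/-- The components of the rigged field, seen as a field along `x`. -/
lemma vecAt_riggedAlong {p : M} {z : EuclideanSpace ℝ (Fin n)}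
    (hz : z ∈ (extChartAt (𝓡 n) p).target)
    (hxz : x ((extChartAt (𝓡 n) p).symm z) ∈ (extChartAt (𝓡 (n + 1)) (x p)).source) :
    vecAt (x p) (x ((extChartAt (𝓡 n) p).symm z))
      (riggedAlong gb x N ((extChartAt (𝓡 n) p).symm z)) =
      fderiv ℝ (mapInChart x p) z (vecInChart (rigged gb x N) p z) := by
  have hq := (extChartAt (𝓡 n) p).map_target hz
  have hd := vecAt_mfderiv_frameAt ((h.smooth_map _).mdifferentiableAt (by simp)) hq hxz
  rw [(extChartAt (𝓡 n) p).right_inv hz] at hd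
  rw [← hd, vecInChart, frameAt_vecAt hq]
  rfl

lemma contDiffAt_riggedAlong (p : M) :
    ContDiffAt ℝ ∞ (fun z ↦ vecAt (x p) (x ((extChartAt (𝓡 n) p).symm z))
      (riggedAlong gb x N ((extChartAt (𝓡 n) p).symm z))) (extChartAt (𝓡 n) p p) := by
  have h1 := contDiffAt_mapInChart (h.smooth_map p)
  refine ((h1.fderiv_right (m := ∞) (by simp)).clm_apply
    (h.contDiffAt_rigged p)).congr_of_eventuallyEq ?_
  filter_upwards [eventually_mem_chart h.smooth_map p] with z hz
  exact h.vecAt_riggedAlong hz.1 hz.2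

/-- The components of the ambient field `N` along `x`. -/
lemma vecAt_rigging {p : M} {z : EuclideanSpace ℝ (Fin n)}
    (hxz : x ((extChartAt (𝓡 n) p).symm z) ∈ (extChartAt (𝓡 (n + 1)) (x p)).source) :
    vecAt (x p) (x ((extChartAt (𝓡 n) p).symm z)) (N (x ((extChartAt (𝓡 n) p).symm z))) =
      vecInChart N (x p) (mapInChart x p z) := by
  rw [vecInChart, symm_mapInChart hxz]

end IsNullRigging

end Hypersurface

/-! ### Functions constant on the leaves of the screen distribution -/

/-- Integral curves of a smooth vector field on a Banach space exist for short time and are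
smooth. -/
lemma exists_smooth_integralCurve {F : Type*} [NormedAddCommGroup F] [NormedSpace ℝ F]
    [CompleteSpace F] {V : F → F} {U : Set F} (hU : IsOpen U) (hV : ContDiffOn ℝ ∞ V U) {z : F}
    (hz : z ∈ U) : ∃ c : ℝ → F, c 0 = z ∧ ∃ ε > 0, ContDiffOn ℝ ∞ c (Set.Ioo (-ε) ε) ∧
      ∀ t ∈ Set.Ioo (-ε) ε, c t ∈ U ∧ HasDerivAt c (V (c t)) t := by
  have hVz : ContDiffAt ℝ 1 V z := (hV.contDiffAt (hU.mem_nhds hz)).of_le (by simp)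
  obtain ⟨c, hc0, ε, hε, hc⟩ :=
    hVz.exists_forall_mem_closedBall_exists_eq_forall_mem_Ioo_hasDerivAt₀ 0
  simp only [zero_sub, zero_add] at hc
  have hcont : ContinuousAt c 0 := (hc 0 (by simp [hε])).continuousAt
  obtain ⟨ε', hε', hball⟩ := Metric.mem_nhds_iff.mp
    (hcont.preimage_mem_nhds (by rw [hc0]; exact hU.mem_nhds hz))
  have hsub : ∀ t ∈ Set.Ioo (-(min ε ε')) (min ε ε'), c t ∈ U ∧ HasDerivAt c (V (c t)) t := by
    intro t ht
    have h1 := min_le_left ε ε'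
    have h2 := min_le_right ε ε'
    refine ⟨hball ?_, hc t ⟨by linarith [ht.1], by linarith [ht.2]⟩⟩
    rw [Metric.mem_ball, Real.dist_eq, sub_zero, abs_lt]
    exact ⟨by linarith [ht.1], by linarith [ht.2]⟩
  refine ⟨c, hc0, min ε ε', lt_min hε hε', ?_, hsub⟩
  -- bootstrapping: `c' = V ∘ c`
  have hk : ∀ k : ℕ, ContDiffOn ℝ k c (Set.Ioo (-(min ε ε')) (min ε ε')) := by
    intro k
    induction k with
    | zero =>
      exact contDiffOn_zero.mpr fun t ht ↦ (hsub t ht).2.continuousAt.continuousWithinAt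
    | succ k ih =>
      rw [Nat.cast_succ, contDiffOn_succ_iff_deriv_of_isOpen isOpen_Ioo]
      refine ⟨fun t ht ↦ (hsub t ht).2.differentiableAt.differentiableWithinAt, by simp, ?_⟩
      refine ContDiffOn.congr ?_ fun t ht ↦ (hsub t ht).2.deriv
      exact (hV.of_le (by exact_mod_cast le_top)).comp ih fun t ht ↦ (hsub t ht).1
  exact contDiffOn_infty.mpr hk

section Charts

variable {m : ℕ} {M : Type*} [TopologicalSpace M] [ChartedSpace (EuclideanSpace ℝ (Fin m)) M]
  [IsManifold (𝓡 m) ∞ M]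

lemma frameAt_symm {p : M} {z : EuclideanSpace ℝ (Fin m)} (hz : z ∈ (extChartAt (𝓡 m) p).target)
    (e : EuclideanSpace ℝ (Fin m)) : frameAt p ((extChartAt (𝓡 m) p).symm z) e =
      mfderiv 𝓘(ℝ, EuclideanSpace ℝ (Fin m)) (𝓡 m) (extChartAt (𝓡 m) p).symm z e := by
  have hq : (extChartAt (𝓡 m) p).symm z ∈ (extChartAt (𝓡 m) p).source :=
    (extChartAt (𝓡 m) p).map_target hz
  have aux : ∀ z', z' = z →
      (mfderiv 𝓘(ℝ, EuclideanSpace ℝ (Fin m)) (𝓡 m) (extChartAt (𝓡 m) p).symm z' e :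
        EuclideanSpace ℝ (Fin m)) =
      mfderiv 𝓘(ℝ, EuclideanSpace ℝ (Fin m)) (𝓡 m) (extChartAt (𝓡 m) p).symm z e := by
    rintro _ rfl
    rfl
  rw [frameAt, TangentBundle.symmL_trivializationAt (by simpa using hq),
    ModelWithCorners.range_eq_univ, mfderivWithin_univ]
  exact aux _ ((extChartAt (𝓡 m) p).right_inv hz)

lemma contMDiffOn_frameAt (p : M) (u : EuclideanSpace ℝ (Fin m)) :
    ContMDiffOn (𝓡 m) (𝓡 m).tangent ∞
      (fun q ↦ (⟨q, frameAt p q u⟩ : TangentBundle (𝓡 m) M)) (extChartAt (𝓡 m) p).source := by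
  intro q hq
  have hbase : ∀ q ∈ (extChartAt (𝓡 m) p).source,
      q ∈ (trivializationAt (EuclideanSpace ℝ (Fin m)) (TangentSpace (𝓡 m)) p).baseSet := by
    intro q hq
    simpa using hq
  rw [(trivializationAt (EuclideanSpace ℝ (Fin m)) (TangentSpace (𝓡 m)) p).contMDiffWithinAt_iff
    (by simpa using hq)]
  refine ⟨contMDiffWithinAt_id, ?_⟩
  refine (contMDiffWithinAt_const (c := u)).congr (fun r hr ↦ ?_) ?_
  · have := vecAt_frameAt hr u
    rwa [vecAt, Trivialization.continuousLinearMapAt_apply,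
      Trivialization.coe_linearMapAt_of_mem _ (hbase r hr)] at this
  · have := vecAt_frameAt hq u
    rwa [vecAt, Trivialization.continuousLinearMapAt_apply,
      Trivialization.coe_linearMapAt_of_mem _ (hbase q hq)] at this

end Charts

section Hypersurface

variable {n : ℕ}
  {Mb : Type*} [TopologicalSpace Mb] [ChartedSpace (EuclideanSpace ℝ (Fin (n + 1))) Mb]
  [IsManifold (𝓡 (n + 1)) ∞ Mb]
  {M : Type*} [TopologicalSpace M] [ChartedSpace (EuclideanSpace ℝ (Fin n)) M]
  [IsManifold (𝓡 n) ∞ M]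
  {gb : BilinField (n + 1) Mb} {x : M → Mb} {N : VectorField (n + 1) Mb}

namespace IsNullRigging

variable (h : IsNullRigging gb x N)
include h

lemma contMDiffOn_eta_frameAt (p : M) (u : EuclideanSpace ℝ (Fin n)) :
    ContMDiffOn (𝓡 n) 𝓘(ℝ, ℝ) ∞ (fun q ↦ eta gb x N q (frameAt p q u))
      (extChartAt (𝓡 n) p).source := by
  have hframe := contMDiffOn_frameAt (m := n) p u
  have hdx : ContMDiffOn (𝓡 n) (𝓡 (n + 1)).tangent ∞
      (fun q ↦ (⟨x q, dx x q (frameAt p q u)⟩ : TangentBundle (𝓡 (n + 1)) Mb))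
      (extChartAt (𝓡 n) p).source :=
    (h.smooth_map.contMDiff_tangentMap (m := ∞) (by simp)).comp_contMDiffOn hframe
  have hN := (h.smooth.comp h.smooth_map).contMDiffOn (s := (extChartAt (𝓡 n) p).source)
  have hg := (h.metric.smooth.comp h.smooth_map).contMDiffOn (s := (extChartAt (𝓡 n) p).source)
  intro q hq
  have key : ContMDiffWithinAt (𝓡 n) ((𝓡 (n + 1)).prod 𝓘(ℝ, ℝ)) ∞
      (fun q ↦ TotalSpace.mk' ℝ (E := Bundle.Trivial Mb ℝ) (x q)
        (gb (x q) (N (x q)) (dx x q (frameAt p q u)))) (extChartAt (𝓡 n) p).source q := by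
    apply ContMDiffWithinAt.clm_bundle_apply₂ (F₁ := EuclideanSpace ℝ (Fin (n + 1)))
      (F₂ := EuclideanSpace ℝ (Fin (n + 1)))
    · exact hg q hq
    · exact hN q hq
    · exact hdx q hq
  exact (contMDiffWithinAt_totalSpace.mp key).2

/-- A function which is constant on the leaves of the screen distribution has vanishing
differential along that distribution, since each screen vector is the velocity of a smooth curve
tangent to the screen distribution. -/
lemma mvfderiv_eq_zero_of_mem_screen {f : M → ℝ} (hf : ContMDiff (𝓡 n) 𝓘(ℝ, ℝ) ∞ f)
    (hleaf : ConstantOnLeaves (screen gb x N) f) {p : M} {u : TangentSpace (𝓡 n) p}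
    (hu : u ∈ screen gb x N p) : mvfderiv (𝓡 n) f p u = 0 := by
  set φ := extChartAt (𝓡 n) p with hφ
  set e : EuclideanSpace ℝ (Fin n) := rigged gb x N p with he
  let u' : EuclideanSpace ℝ (Fin n) := u
  let η : EuclideanSpace ℝ (Fin n) → EuclideanSpace ℝ (Fin n) → ℝ :=
    fun v z ↦ eta gb x N (φ.symm z) (frameAt p (φ.symm z) v)
  have hη : ∀ v, ContDiffOn ℝ ∞ (η v) φ.target := fun v ↦ by
    rw [← contMDiffOn_iff_contDiffOn]
    exact (h.contMDiffOn_eta_frameAt p v).comp (contMDiffOn_extChartAt_symm p)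
      fun z hz ↦ φ.map_target hz
  have hη0 : ∀ v : EuclideanSpace ℝ (Fin n), η v (φ p) = eta gb x N p v := by
    intro v
    have : ∀ q, q = p → eta gb x N q (frameAt p q v) = eta gb x N p v := by
      rintro _ rfl
      rw [frameAt_self]
    exact this _ (extChartAt_to_inv p)
  -- the combination of the constant fields `u'` and `e` that is annihilated by `η`; at `p`, where
  -- `η(u') = 0` and `η(e) = 1`, it equals `u'`
  let V : EuclideanSpace ℝ (Fin n) → EuclideanSpace ℝ (Fin n) := fun z ↦ η e z • u' - η u' z • e
  have hV : ContDiffOn ℝ ∞ V φ.target :=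
    ((hη e).smul contDiffOn_const).sub ((hη u').smul contDiffOn_const)
  have hVz : V (φ p) = u' := by
    have h1 : η e (φ p) = 1 := (hη0 e).trans (h.rigged_spec p).2
    have h2 : η u' (φ p) = 0 := (hη0 u').trans hu
    simp only [V, h1, h2, one_smul, zero_smul, sub_zero]
  have hVη : ∀ z, eta gb x N (φ.symm z) (frameAt p (φ.symm z) (V z)) = 0 := by
    intro z
    simp only [V, map_sub, map_smul, smul_eq_mul]
    exact sub_eq_zero.mpr (mul_comm _ _)
  obtain ⟨c, hc0, ε, hε, hcs, hc⟩ := exists_smooth_integralCurve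
    (isOpen_extChartAt_target p) hV (mem_extChartAt_target p)
  -- `f` is constant along the integral curve
  have hconst : ∀ s ∈ Set.Ioo (-ε) ε, f (φ.symm (c s)) = f p := by
    intro s hs
    -- leaves are defined by curves on all of `ℝ`, so the time interval `(-ε, ε)` is parametrised by
    -- a function bounded by `|s|` which vanishes at `0` and takes the value `s` at `1`
    let σ : ℝ → ℝ := fun t ↦ s * Real.sin (Real.pi / 2 * t)
    have hσ : ContDiff ℝ ∞ σ := by fun_prop
    have hσmem : ∀ t, σ t ∈ Set.Ioo (-ε) ε := by
      intro t
      have h1 : |σ t| ≤ |s| := by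
        rw [abs_mul]
        exact mul_le_of_le_one_right (abs_nonneg _) (Real.abs_sin_le_one _)
      exact abs_lt.mp (h1.trans_lt (abs_lt.mpr hs))
    have hcσ : ContDiff ℝ ∞ (c ∘ σ) :=
      contDiffOn_univ.mp (hcs.comp hσ.contDiffOn fun t _ ↦ hσmem t)
    have hcσ' : ∀ t, c (σ t) ∈ φ.target := fun t ↦ (hc _ (hσmem t)).1
    have hγ : ContMDiff 𝓘(ℝ, ℝ) (𝓡 n) ∞ (φ.symm ∘ (c ∘ σ)) := by
      rw [← contMDiffOn_univ]
      exact (contMDiffOn_extChartAt_symm p).comp hcσ.contMDiff.contMDiffOn fun t _ ↦ hcσ' t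
    refine hleaf p _ ⟨φ.symm ∘ (c ∘ σ), hγ, ?_, ?_, fun t ↦ ?_⟩
    · simp [σ, hc0, hφ]
    · simp [σ]
    · have hderiv : HasDerivAt (c ∘ σ) (deriv σ t • V (c (σ t))) t :=
        (hc _ (hσmem t)).2.scomp t (hσ.differentiable (by simp) t).hasDerivAt
      have h1 : mfderiv 𝓘(ℝ, ℝ) (𝓡 n) (φ.symm ∘ (c ∘ σ)) t (1 : ℝ) =
          mfderiv 𝓘(ℝ, EuclideanSpace ℝ (Fin n)) (𝓡 n) φ.symm (c (σ t))
            (mfderiv 𝓘(ℝ, ℝ) 𝓘(ℝ, EuclideanSpace ℝ (Fin n)) (c ∘ σ) t (1 : ℝ)) := by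
        refine mfderiv_comp_apply t ?_ hderiv.differentiableAt.mdifferentiableAt _
        exact ((contMDiffOn_extChartAt_symm p).contMDiffAt
          ((isOpen_extChartAt_target p).mem_nhds (hcσ' t))).mdifferentiableAt (n := ∞) (by simp)
      have h2 : (mfderiv 𝓘(ℝ, ℝ) 𝓘(ℝ, EuclideanSpace ℝ (Fin n)) (c ∘ σ) t (1 : ℝ) :
          EuclideanSpace ℝ (Fin n)) = deriv σ t • V (c (σ t)) := by
        rw [mfderiv_eq_fderiv]
        exact (fderiv_apply_one_eq_deriv).trans hderiv.deriv
      have h3 : mfderiv 𝓘(ℝ, ℝ) (𝓡 n) (φ.symm ∘ (c ∘ σ)) t (1 : ℝ) =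
          frameAt p (φ.symm (c (σ t))) (deriv σ t • V (c (σ t))) := by
        rw [h1, frameAt_symm (hcσ' t), h2]
      rw [h3, map_smul]
      exact Submodule.smul_mem _ _ (mem_screen.mpr (hVη _))
  have hA : DifferentiableAt ℝ (f ∘ φ.symm) (c 0) := by
    rw [hc0]
    exact (contMDiffAt_iff_chart.mp (hf p)).differentiableAt (by simp)
  have h0 : (0 : ℝ) ∈ Set.Ioo (-ε) ε := ⟨by linarith, hε⟩
  have hd : HasDerivAt ((f ∘ φ.symm) ∘ c) (fderiv ℝ (f ∘ φ.symm) (c 0) (V (c 0))) 0 :=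
    hA.hasFDerivAt.comp_hasDerivAt 0 (hc 0 h0).2
  have hd' : HasDerivAt ((f ∘ φ.symm) ∘ c) 0 0 := by
    refine (hasDerivAt_const (0 : ℝ) (f p)).congr_of_eventuallyEq ?_
    filter_upwards [Ioo_mem_nhds h0.1 h0.2] with s hs
    exact hconst s hs
  have := hd.unique hd'
  rw [hc0, hVz] at this
  rw [mvfderiv_eq_fderiv ((hf p).mdifferentiableAt (by simp))]
  exact this

end IsNullRigging

end Hypersurface

/-! ### The Gauss map and its shape operator -/

section LocalGauss

variable {E F : Type*} [NormedAddCommGroup E] [NormedSpace ℝ E]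
  [NormedAddCommGroup F] [NormedSpace ℝ F]

lemma localChristoffel_congr {G G' : E → E →L[ℝ] E →L[ℝ] ℝ} {y : E} (h : G =ᶠ[𝓝 y] G')
    (u v : E) : localChristoffel G y u v = localChristoffel G' y u v := by
  rw [localChristoffel, localChristoffel, h.fderiv_eq, h.eq_of_nhds]

lemma abs_eq_sign_mul (t : ℝ) : |t| = Real.sign t * t := by
  rcases lt_trichotomy t 0 with h | h | h
  · rw [Real.sign_of_neg h, abs_of_neg h, neg_one_mul]
  · simp [h]
  · rw [Real.sign_of_pos h, abs_of_pos h, one_mul]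

lemma sign_mul_sign {t : ℝ} (ht : t ≠ 0) : Real.sign t * Real.sign t = 1 := by
  rcases Real.sign_apply_eq_of_ne_zero t ht with h | h <;> simp [h]

/-- The field `√|A| U - (sign A / √|A|) Z`. -/
def localGauss (A : F → ℝ) (U Z : F → E) (z : F) : E :=
  √|A z| • U z - (Real.sign (A z) / √|A z|) • Z z

variable {A : F → ℝ} {U Z : F → E} {z : F}

/-- The sign of `A` is locally constant, so that it can be frozen when differentiating. -/
lemma localGauss_eventuallyEq (hA : ContinuousAt A z) (h0 : A z ≠ 0) :
    localGauss A U Z =ᶠ[𝓝 z] fun z' ↦ √(Real.sign (A z) * A z') • U z' -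
      (Real.sign (A z) * (√(Real.sign (A z) * A z'))⁻¹) • Z z' := by
  have hsign : ∀ᶠ z' in 𝓝 z, Real.sign (A z') = Real.sign (A z) := by
    rcases lt_or_gt_of_ne h0 with h | h
    · filter_upwards [hA.eventually_lt continuousAt_const h] with z' hz'
      rw [Real.sign_of_neg h, Real.sign_of_neg hz']
    · filter_upwards [continuousAt_const.eventually_lt hA h] with z' hz'
      rw [Real.sign_of_pos h, Real.sign_of_pos hz']
  filter_upwards [hsign] with z' hz'
  rw [localGauss, abs_eq_sign_mul, hz', div_eq_mul_inv]

lemma contDiffAt_localGauss (hA : ContDiffAt ℝ ∞ A z) (hU : ContDiffAt ℝ ∞ U z)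
    (hZ : ContDiffAt ℝ ∞ Z z) (h0 : A z ≠ 0) : ContDiffAt ℝ ∞ (localGauss A U Z) z := by
  refine ContDiffAt.congr_of_eventuallyEq ?_ (localGauss_eventuallyEq hA.continuousAt h0)
  have hpos : Real.sign (A z) * A z ≠ 0 := by
    rw [← abs_eq_sign_mul]
    exact abs_ne_zero.mpr h0
  have hr : ContDiffAt ℝ ∞ (fun z' ↦ √(Real.sign (A z) * A z')) z :=
    (contDiffAt_const.mul hA).sqrt hpos
  have hr0 : √(Real.sign (A z) * A z) ≠ 0 := by
    rw [← abs_eq_sign_mul]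
    exact Real.sqrt_ne_zero'.mpr (abs_pos.mpr h0)
  exact (hr.smul hU).sub ((contDiffAt_const.mul (hr.inv hr0)).smul hZ)

lemma fderiv_localGauss {A' : F →L[ℝ] ℝ} {U' Z' : F →L[ℝ] E} (hA : HasFDerivAt A A' z)
    (hU : HasFDerivAt U U' z) (hZ : HasFDerivAt Z Z' z) (h0 : A z ≠ 0) (e : F) :
    fderiv ℝ (localGauss A U Z) z e =
      (Real.sign (A z) * A' e / (2 * √|A z|)) • U z + √|A z| • U' e
        + (A' e / (2 * √|A z| ^ 3)) • Z z - (Real.sign (A z) / √|A z|) • Z' e := by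
  have hpos : Real.sign (A z) * A z ≠ 0 := by
    rw [← abs_eq_sign_mul]
    exact abs_ne_zero.mpr h0
  have hr := (hA.const_mul (Real.sign (A z))).sqrt hpos
  have hr0 : √(Real.sign (A z) * A z) ≠ 0 := by
    rw [← abs_eq_sign_mul]
    exact Real.sqrt_ne_zero'.mpr (abs_pos.mpr h0)
  have hinv := (hasDerivAt_inv hr0).comp_hasFDerivAt z hr
  have h1 := (hr.smul hU).sub ((hinv.const_mul (Real.sign (A z))).smul hZ)
  rw [(localGauss_eventuallyEq hA.continuousAt h0).fderiv_eq]
  refine (congrArg (fun L : F →L[ℝ] E ↦ L e) h1.fderiv).trans ?_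
  have hss := sign_mul_sign h0
  simp only [add_apply, sub_apply, smul_apply, ContinuousLinearMap.smulRight_apply, smul_eq_mul,
    Function.comp_apply]
  rw [abs_eq_sign_mul]
  generalize √(Real.sign (A z) * A z) = r at *
  match_scalars
  · field_simp
  · ring
  · field_simp
  · linear_combination (A' e * r⁻¹ ^ 3 / 2) * hss

end LocalGauss

section Maps

variable {m k : ℕ} {M : Type*} [TopologicalSpace M] [ChartedSpace (EuclideanSpace ℝ (Fin m)) M]
  [IsManifold (𝓡 m) ∞ M] {N : Type*} [TopologicalSpace N]
  [ChartedSpace (EuclideanSpace ℝ (Fin k)) N] [IsManifold (𝓡 k) ∞ N] {f : N → M}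

lemma mfderiv_eq_fderiv_mapInChart {p : N} (hf : MDifferentiableAt (𝓡 k) (𝓡 m) f p)
    (v : EuclideanSpace ℝ (Fin k)) : mfderiv (𝓡 k) (𝓡 m) f p v =
      fderiv ℝ (mapInChart (m := m) f p) (extChartAt (𝓡 k) p p) v := by
  have := vecAt_mfderiv_frameAt (p := p) hf (by simp) (by simp) v
  rwa [frameAt_self, vecAt_self] at this

/-- The components of a vector field along `f`, in the preferred charts at `p` and `f p`. -/
def alongInChart (V : ∀ q : N, TangentSpace (𝓡 m) (f q)) (p : N) (z : EuclideanSpace ℝ (Fin k)) :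
    EuclideanSpace ℝ (Fin m) :=
  vecAt (f p) (f ((extChartAt (𝓡 k) p).symm z)) (V ((extChartAt (𝓡 k) p).symm z))

lemma alongInChart_self (V : ∀ q : N, TangentSpace (𝓡 m) (f q)) (p : N) :
    alongInChart V p (extChartAt (𝓡 k) p p) = V p := by
  have : ∀ q, q = p → (vecAt (f p) (f q) (V q) : EuclideanSpace ℝ (Fin m)) = V p := by
    rintro _ rfl
    exact vecAt_self _ _
  exact this _ (extChartAt_to_inv p)

/-- The covariant derivative of a vector field along a map, in coordinates. -/
lemma covDerivAlong_eq (g : BilinField m M) {V : ∀ q : N, TangentSpace (𝓡 m) (f q)} {p : N}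
    (hf : ContMDiffAt (𝓡 k) (𝓡 m) ∞ f p)
    (hV : ContDiffAt ℝ ∞ (alongInChart V p) (extChartAt (𝓡 k) p p))
    (v : EuclideanSpace ℝ (Fin k)) :
    covDerivAlong g f V p v = fderiv ℝ (alongInChart V p) (extChartAt (𝓡 k) p p) v +
      localChristoffel (bilinInChart g (f p)) (mapInChart f p (extChartAt (𝓡 k) p p))
        (fderiv ℝ (mapInChart (m := m) f p) (extChartAt (𝓡 k) p p) v)
        (alongInChart V p (extChartAt (𝓡 k) p p)) := by
  have h1 : MDifferentiableAt (𝓡 k) 𝓘(ℝ, EuclideanSpace ℝ (Fin m))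
      (fun q ↦ vecAt (f p) (f q) (V q)) p :=
    (contMDiffAt_iff_chart.mpr hV).mdifferentiableAt (by simp)
  have h2 := mvfderiv_eq_fderiv h1 v
  rw [alongInChart_self, mapInChart_self, ← mfderiv_eq_fderiv_mapInChart
    (hf.mdifferentiableAt (by simp))]
  exact congrArg (· + localChristoffel (bilinInChart g (f p)) (extChartAt (𝓡 m) (f p) (f p))
    (mfderiv (𝓡 k) (𝓡 m) f p v) (V p)) h2

end Maps

section Hypersurface

variable {n : ℕ}
  {Mb : Type*} [TopologicalSpace Mb] [ChartedSpace (EuclideanSpace ℝ (Fin (n + 1))) Mb]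
  [IsManifold (𝓡 (n + 1)) ∞ Mb]
  {M : Type*} [TopologicalSpace M] [ChartedSpace (EuclideanSpace ℝ (Fin n)) M]
  [IsManifold (𝓡 n) ∞ M]
  {gb : BilinField (n + 1) Mb} {x : M → Mb} {N : VectorField (n + 1) Mb} {α : Mb → ℝ}

namespace IsNullRigging

variable (h : IsNullRigging gb x N)
include h

lemma contDiffAt_alongInChart_rigging (p : M) :
    ContDiffAt ℝ ∞ (vecInChart N (x p) ∘ mapInChart x p) (extChartAt (𝓡 n) p p) := by
  have h3 := contDiffAt_vecInChart h.smooth (x p)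
  rw [← mapInChart_self (m := n + 1) (k := n) x p] at h3
  exact h3.comp _ (contDiffAt_mapInChart (h.smooth_map p))

lemma alongInChart_rigging_eventuallyEq (p : M) :
    alongInChart (f := x) (fun q ↦ N (x q)) p =ᶠ[𝓝 (extChartAt (𝓡 n) p p)]
      vecInChart N (x p) ∘ mapInChart x p := by
  filter_upwards [eventually_mem_chart h.smooth_map p] with z hz
  exact h.vecAt_rigging hz.2

lemma alongInChart_gaussMap_eventuallyEq (p : M) :
    alongInChart (gaussMap gb x N α) p =ᶠ[𝓝 (extChartAt (𝓡 n) p p)]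
      localGauss ((α ∘ (extChartAt (𝓡 (n + 1)) (x p)).symm) ∘ mapInChart x p)
        (vecInChart N (x p) ∘ mapInChart x p) (alongInChart (riggedAlong gb x N) p) := by
  filter_upwards [eventually_mem_chart h.smooth_map p] with z hz
  rw [alongInChart, gaussMap, map_sub, map_smul, map_smul, h.vecAt_rigging hz.2, localGauss,
    Function.comp_apply, Function.comp_apply, Function.comp_apply, symm_mapInChart hz.2]
  rfl

lemma contDiffAt_comp_mapInChart (hα : ContMDiff (𝓡 (n + 1)) 𝓘(ℝ, ℝ) ∞ α) (p : M) :
    ContDiffAt ℝ ∞ ((α ∘ (extChartAt (𝓡 (n + 1)) (x p)).symm) ∘ mapInChart x p)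
      (extChartAt (𝓡 n) p p) := by
  have h3 := contDiffAt_comp_symm hα (x p)
  rw [← mapInChart_self (m := n + 1) (k := n) x p] at h3
  exact h3.comp _ (contDiffAt_mapInChart (h.smooth_map p))

lemma comp_mapInChart_self (α : Mb → ℝ) (p : M) :
    ((α ∘ (extChartAt (𝓡 (n + 1)) (x p)).symm) ∘ mapInChart x p) (extChartAt (𝓡 n) p p) =
      α (x p) := by
  rw [Function.comp_apply, mapInChart_self, Function.comp_apply, extChartAt_to_inv]

lemma contDiffAt_gaussMap (hα : ContMDiff (𝓡 (n + 1)) 𝓘(ℝ, ℝ) ∞ α) (hα0 : ∀ y, α y ≠ 0) (p : M) :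
    ContDiffAt ℝ ∞ (alongInChart (gaussMap gb x N α) p) (extChartAt (𝓡 n) p p) :=
  (contDiffAt_localGauss (h.contDiffAt_comp_mapInChart hα p)
    (h.contDiffAt_alongInChart_rigging p) (h.contDiffAt_riggedAlong p)
    (by rw [h.comp_mapInChart_self]; exact hα0 _)).congr_of_eventuallyEq
      (h.alongInChart_gaussMap_eventuallyEq p)

lemma isUnitNormal_gaussMap (hα : ContMDiff (𝓡 (n + 1)) 𝓘(ℝ, ℝ) ∞ α) (hα0 : ∀ y, α y ≠ 0) :
    IsUnitNormal (twisted gb N α) x (gaussMap gb x N α) (fun p ↦ -Real.sign (α (x p))) where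
  smooth p := (contMDiffAt_vec_iff (h.smooth_map p)).mpr
    (contMDiffAt_iff_chart.mpr (h.contDiffAt_gaussMap hα hα0 p))
  normal p v := by
    have hr : √|α (x p)| ≠ 0 := Real.sqrt_ne_zero'.mpr (abs_pos.mpr (hα0 _))
    have hrr : √|α (x p)| * √|α (x p)| = Real.sign (α (x p)) * α (x p) := by
      rw [Real.mul_self_sqrt (abs_nonneg _), abs_eq_sign_mul]
    rw [twisted_apply, gaussMap]
    simp only [map_sub, map_smul, sub_apply, smul_apply, smul_eq_mul, h.null,
      h.gb_riggedAlong, h.gb_rigging_riggedAlong]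
    field_simp
    linear_combination (gb (x p) (N (x p)) (dx x p v)) * hrr
  unit p := by
    have hr : √|α (x p)| ≠ 0 := Real.sqrt_ne_zero'.mpr (abs_pos.mpr (hα0 _))
    have hrr : √|α (x p)| * √|α (x p)| = Real.sign (α (x p)) * α (x p) := by
      rw [Real.mul_self_sqrt (abs_nonneg _), abs_eq_sign_mul]
    rw [twisted_apply, gaussMap]
    have hsymm : gb (x p) (riggedAlong gb x N p) (N (x p)) = 1 := by
      rw [h.metric.symm, h.gb_rigging_riggedAlong]
    simp only [map_sub, map_smul, sub_apply, smul_apply, smul_eq_mul, h.null,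
      h.gb_riggedAlong_self, h.gb_rigging_riggedAlong, hsymm]
    field_simp
    linear_combination (-Real.sign (α (x p))) * hrr
  sign p := by
    rcases Real.sign_apply_eq_of_ne_zero _ (hα0 (x p)) with h1 | h1 <;> simp [h1]

/-- The Weingarten formula: the covariant derivative of the Gauss map is tangent to the
radical. -/
lemma covDerivAlong_gaussMap (hclosed : IsClosedForm (flat gb N))
    (hα : ContMDiff (𝓡 (n + 1)) 𝓘(ℝ, ℝ) ∞ α) (hα0 : ∀ y, α y ≠ 0)
    (hleaves : ConstantOnLeaves (screen gb x N) fun p ↦ α (x p))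
    (hconf : HasConformalScreen gb x N fun p ↦ 1 / α (x p)) (p : M)
    (v : TangentSpace (𝓡 n) p) :
    covDerivAlong (twisted gb N α) x (gaussMap gb x N α) p v =
      -(curvatureValue gb x N α p * eta gb x N p v) • riggedAlong gb x N p := by
  have hx1 : MDifferentiableAt (𝓡 n) (𝓡 (n + 1)) x p :=
    (h.smooth_map p).mdifferentiableAt (by simp)
  set z := extChartAt (𝓡 n) p p with hz
  set X := mapInChart (m := n + 1) (k := n) x p with hX
  set G := bilinInChart gb (x p) with hGdef
  set Nh := vecInChart N (x p) with hNh
  set a := α ∘ (extChartAt (𝓡 (n + 1)) (x p)).symm with ha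
  set Z := alongInChart (m := n + 1) (k := n) (riggedAlong gb x N) p with hZ
  -- values at the base point
  have b1 : X z = extChartAt (𝓡 (n + 1)) (x p) (x p) :=
    mapInChart_self (m := n + 1) (k := n) x p
  have b2 : G (X z) = gb (x p) := by rw [b1, hGdef, bilinInChart_self]
  have b3 : Nh (X z) = N (x p) := by rw [b1, hNh, vecInChart_self]
  have b4 : Z z = riggedAlong gb x N p := alongInChart_self _ p
  have b5 : ∀ e : EuclideanSpace ℝ (Fin n), dx x p e = fderiv ℝ X z e := fun e ↦
    mfderiv_eq_fderiv_mapInChart hx1 e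
  have b6 : a (X z) = α (x p) := h.comp_mapInChart_self α p
  have hmem : ∀ᶠ y in 𝓝 (X z), (extChartAt (𝓡 (n + 1)) (x p)).symm y ∈
      (extChartAt (𝓡 (n + 1)) (x p)).source := by
    rw [b1]
    exact chart_symm_mem (x p)
  -- smoothness of the components
  have sX : ContDiffAt ℝ ∞ X z := contDiffAt_mapInChart (h.smooth_map p)
  have sG : ContDiffAt ℝ ∞ G (X z) := by rw [b1]; exact contDiffAt_bilinInChart h.metric (x p)
  have sN : ContDiffAt ℝ ∞ Nh (X z) := by rw [b1]; exact contDiffAt_vecInChart h.smooth (x p)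
  have sa : ContDiffAt ℝ ∞ a (X z) := by rw [b1]; exact contDiffAt_comp_symm hα (x p)
  have sZ : ContDiffAt ℝ ∞ Z z := h.contDiffAt_riggedAlong p
  have sδ := h.contDiffAt_gaussMap hα hα0 p
  have dX : HasFDerivAt X (fderiv ℝ X z) z := (sX.differentiableAt (by simp)).hasFDerivAt
  have dN : HasFDerivAt Nh (fderiv ℝ Nh (X z)) (X z) :=
    (sN.differentiableAt (by simp)).hasFDerivAt
  have da : HasFDerivAt a (fderiv ℝ a (X z)) (X z) := (sa.differentiableAt (by simp)).hasFDerivAt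
  have dZ : HasFDerivAt Z (fderiv ℝ Z z) z := (sZ.differentiableAt (by simp)).hasFDerivAt
  -- the covariant derivatives in coordinates
  have cN : ∀ e : EuclideanSpace ℝ (Fin n), covDerivAlong gb x (fun q ↦ N (x q)) p e =
      fderiv ℝ Nh (X z) (fderiv ℝ X z e) + localChristoffel G (X z) (fderiv ℝ X z e)
        (Nh (X z)) := by
    intro e
    have he := h.alongInChart_rigging_eventuallyEq p
    rw [covDerivAlong_eq gb (h.smooth_map p)
      ((h.contDiffAt_alongInChart_rigging p).congr_of_eventuallyEq he), he.fderiv_eq,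
      he.eq_of_nhds, HasFDerivAt.fderiv (dN.comp z dX)]
    rfl
  have cZ : ∀ e : EuclideanSpace ℝ (Fin n), covDerivAlong gb x (riggedAlong gb x N) p e =
      fderiv ℝ Z z e + localChristoffel G (X z) (fderiv ℝ X z e) (Z z) := fun e ↦
    covDerivAlong_eq gb (h.smooth_map p) sZ e
  have hTw : bilinInChart (twisted gb N α) (x p) =ᶠ[𝓝 (X z)] localTwist G a Nh := by
    filter_upwards [hmem] with y hy
    exact bilinInChart_twisted hy
  have eδ := h.alongInChart_gaussMap_eventuallyEq (α := α) p
  have cδ : covDerivAlong (twisted gb N α) x (gaussMap gb x N α) p v =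
      fderiv ℝ (localGauss (a ∘ X) (Nh ∘ X) Z) z v + localChristoffel (localTwist G a Nh) (X z)
        (fderiv ℝ X z v) (localGauss (a ∘ X) (Nh ∘ X) Z z) := by
    refine (covDerivAlong_eq (twisted gb N α) (h.smooth_map p) sδ v).trans ?_
    rw [eδ.fderiv_eq, eδ.eq_of_nhds]
    exact congrArg _ (localChristoffel_congr hTw _ _)
  -- the differential of `α` along `M`
  have hαx : ContMDiff (𝓡 n) 𝓘(ℝ, ℝ) ∞ fun q ↦ α (x q) := hα.comp h.smooth_map
  have cα : ∀ e : EuclideanSpace ℝ (Fin n), mvfderiv (𝓡 n) (fun q ↦ α (x q)) p e =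
      fderiv ℝ a (X z) (fderiv ℝ X z e) := by
    intro e
    have he : (fun q ↦ α (x q)) ∘ (extChartAt (𝓡 n) p).symm =ᶠ[𝓝 z] a ∘ X := by
      filter_upwards [eventually_mem_chart h.smooth_map p] with z' hz'
      rw [Function.comp_apply, Function.comp_apply, ha, Function.comp_apply,
        symm_mapInChart hz'.2]
    have hd : fderiv ℝ ((fun q ↦ α (x q)) ∘ (extChartAt (𝓡 n) p).symm) z =
        (fderiv ℝ a (X z)).comp (fderiv ℝ X z) :=
      he.fderiv_eq.trans (da.comp z dX).fderiv
    exact (mvfderiv_eq_fderiv ((hαx p).mdifferentiableAt (by simp)) _).trans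
      (DFunLike.congr_fun hd e)
  have cα' : ∀ w : EuclideanSpace ℝ (Fin (n + 1)), mvfderiv (𝓡 (n + 1)) α (x p) w =
      fderiv ℝ a (X z) w := by
    intro w
    rw [b1]
    exact mvfderiv_eq_fderiv ((hα (x p)).mdifferentiableAt (by simp)) _
  have hα0' : a (X z) ≠ 0 := by rw [b6]; exact hα0 _
  have key := covDeriv_localTwist (G := G) (N := Nh) (a := a) (X := X) (Z := Z)
    (δ := localGauss (a ∘ X) (Nh ∘ X) Z) (δ' := fderiv ℝ (localGauss (a ∘ X) (Nh ∘ X) Z) z)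
    (z := z) (ζ := rigged gb x N p) (r := √|a (X z)|) (s := Real.sign (a (X z)))
    (bilinAt_isInvertible (hmem.self_of_nhds) (h.metric.nondegenerate _))
    (by
      rw [← hTw.eq_of_nhds]
      exact bilinAt_isInvertible (hmem.self_of_nhds)
        ((h.isSemiRiemannianMetric_twisted hα).nondegenerate _))
    (sG.differentiableAt (by simp))
    (Eventually.of_forall fun y ↦ bilinInChart_symm h.metric (x p) y)
    dN da
    (by
      filter_upwards [hmem] with y hy
      exact (bilinAt_vecAt gb hy _ _).trans (h.null _))
    (by
      have he : (fun y ↦ G y (Nh y)) =ᶠ[𝓝 (X z)] oneFormInChart (flat gb N) (x p) := by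
        filter_upwards [hmem] with y hy
        exact bilinInChart_vecInChart gb N hy
      rw [he.fderiv_eq, b1]
      exact hclosed (x p))
    (contDiffAt_infty.mp sX 2)
    dZ
    (by
      filter_upwards [eventually_mem_chart h.smooth_map p] with z' hz' e
      have hq := (extChartAt (𝓡 n) p).map_target hz'.1
      have hd := vecAt_mfderiv_frameAt (p := p) ((h.smooth_map _).mdifferentiableAt (by simp))
        hq hz'.2 e
      rw [(extChartAt (𝓡 n) p).right_inv hz'.1] at hd
      rw [hGdef, bilinInChart_eq, hX, symm_mapInChart hz'.2, ← hd]
      exact (bilinAt_vecAt gb hz'.2 _ _).trans (h.gb_riggedAlong _ _))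
    (by
      filter_upwards [eventually_mem_chart h.smooth_map p] with z' hz'
      rw [hGdef, bilinInChart_eq, hX, symm_mapInChart hz'.2]
      exact (bilinAt_vecAt gb hz'.2 _ _).trans (h.gb_riggedAlong_self _))
    (by rw [b2, b3, b4]; exact h.gb_rigging_riggedAlong p)
    (b4.trans (b5 _))
    (fun w ↦ by
      obtain ⟨e, c, hw⟩ := h.exists_eq_add_smul p w
      exact ⟨e, c, hw.trans (congrArg₂
        (fun s t : EuclideanSpace ℝ (Fin (n + 1)) ↦ s + c • t) (b5 e) b3.symm)⟩)
    (Real.sqrt_ne_zero'.mpr (abs_pos.mpr hα0'))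
    (sign_mul_sign hα0')
    (by rw [Real.mul_self_sqrt (abs_nonneg _), abs_eq_sign_mul, ← mul_assoc,
      sign_mul_sign hα0', one_mul])
    rfl
    (fun e ↦ fderiv_localGauss (da.comp z dX) (dN.comp z dX) dZ hα0' e)
    (fun e he ↦ by
      rw [← cα]
      refine h.mvfderiv_eq_zero_of_mem_screen hαx hleaves ?_
      rw [b2, b3, ← b5] at he
      exact he)
    (fun e ↦ by
      have hc := hconf p e
      simp only [shapeN, shapeXi, tangentPart, tau] at hc
      rw [cN, cZ] at hc
      rw [b2, b3, b4, b6]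
      rw [b3, b4] at hc
      exact hc)
    v
  refine cδ.trans (key.trans ?_)
  -- the ingredients of the principal curvature in coordinates
  have hξ : fderiv ℝ X z (rigged gb x N p) = Z z := (b4.trans (b5 _)).symm
  have hτ : tau gb x N p (rigged gb x N p) = G (X z)
      (fderiv ℝ Nh (X z) (Z z) + localChristoffel G (X z) (Z z) (Nh (X z))) (Z z) := by
    have h1 := cN (rigged gb x N p)
    rw [hξ] at h1
    exact (congrArg (fun w ↦ gb (x p) w (riggedAlong gb x N p)) h1).trans
      (by rw [b2, b4]; rfl)
  have hθ : eta gb x N p v = G (X z) (Nh (X z)) (fderiv ℝ X z v) := by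
    rw [b2, b3]
    exact congrArg (fun w ↦ gb (x p) (N (x p)) w) (b5 v)
  have hsharp : eta gb x N p (sharp (associated gb x N α)
      (fun q ↦ mvfderiv (𝓡 n) (fun r ↦ α (x r)) q) p) = fderiv ℝ a (X z) (Z z) / a (X z) := by
    rw [h.eta_sharp hα0 _ p (fun w hw ↦ h.mvfderiv_eq_zero_of_mem_screen hαx hleaves hw), b6, ← hξ]
    exact congrArg (· / α (x p)) (cα _)
  have hdN : mvfderiv (𝓡 (n + 1)) α (x p) (N (x p)) = fderiv ℝ a (X z) (Nh (X z)) :=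
    (cα' _).trans (by rw [b3])
  refine congrArg₂ (fun (s : ℝ) (w : EuclideanSpace ℝ (Fin (n + 1))) ↦ s • w) ?_ b4
  rw [curvatureValue, hτ, hsharp, hdN, hθ, ← b6]
  ring

end IsNullRigging

end Hypersurface

end RiggedNull

end

/-! ### The principal curvatures -/

theorem mainTheorem2 {n : ℕ}
    {Mb : Type*} [TopologicalSpace Mb] [T2Space Mb] [SecondCountableTopology Mb]
    [ConnectedSpace Mb] [ChartedSpace (EuclideanSpace ℝ (Fin (n + 1))) Mb]
    [IsManifold (𝓡 (n + 1)) ∞ Mb]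
    {M : Type*} [TopologicalSpace M] [T2Space M] [SecondCountableTopology M]
    [ConnectedSpace M] [ChartedSpace (EuclideanSpace ℝ (Fin n)) M]
    [IsManifold (𝓡 n) ∞ M]
    (gb : RiggedNull.BilinField (n + 1) Mb) (hgb : RiggedNull.IsSemiRiemannianMetric gb)
    (x : M → Mb) (hx : Manifold.IsSmoothEmbedding (𝓡 n) (𝓡 (n + 1)) ∞ x)
    (hnull : RiggedNull.IsNullHypersurface gb x)
    (N : RiggedNull.VectorField (n + 1) Mb)
    (hN : ContMDiff (𝓡 (n + 1)) (𝓡 (n + 1)).tangent ∞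
      (fun y ↦ (⟨y, N y⟩ : TangentBundle (𝓡 (n + 1)) Mb)))
    (hN_lightlike : ∀ y : Mb, N y ≠ 0 ∧ gb y (N y) (N y) = 0)
    (hN_rigging : ∀ p : M, N (x p) ∉ Set.range (RiggedNull.dx x p))
    (hN_closed : RiggedNull.IsClosedForm (RiggedNull.flat gb N))
    (α : Mb → ℝ) (hα : ContMDiff (𝓡 (n + 1)) 𝓘(ℝ, ℝ) ∞ α) (hα_ne : ∀ y : Mb, α y ≠ 0)
    (hα_leaves : RiggedNull.ConstantOnLeaves (RiggedNull.screen gb x N) (fun p ↦ α (x p)))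
    (hconf : RiggedNull.HasConformalScreen gb x N (fun p ↦ 1 / α (x p))) :
    -- the twisted metric is a metric, and `(M, g_α)` is a non-degenerate hypersurface of it
    RiggedNull.IsSemiRiemannianMetric (RiggedNull.twisted gb N α) ∧
    RiggedNull.IsSemiRiemannianMetric (RiggedNull.associated gb x N α) ∧
    RiggedNull.pullBilin x (RiggedNull.twisted gb N α) = RiggedNull.associated gb x N α ∧
    -- its Gauss map
    RiggedNull.IsUnitNormal (RiggedNull.twisted gb N α) x (RiggedNull.gaussMap gb x N α)
      (fun p ↦ -Real.sign (α (x p))) ∧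
    -- its shape operator and principal curvatures
    ∃ A : ∀ p : M, Module.End ℝ (TangentSpace (𝓡 n) p),
      RiggedNull.IsShapeOperator (RiggedNull.twisted gb N α) x (RiggedNull.gaussMap gb x N α) A ∧
      ∀ p : M,
        IsCompl (RiggedNull.screen gb x N p) (RiggedNull.radical gb x p) ∧
        Module.finrank ℝ (RiggedNull.screen gb x N p) + 1 = n ∧
        Module.finrank ℝ (RiggedNull.radical gb x p) = 1 ∧
        (∀ v ∈ RiggedNull.screen gb x N p, A p v = 0) ∧
        (∀ v ∈ RiggedNull.radical gb x p, A p v = RiggedNull.curvatureValue gb x N α p • v) ∧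
        (∀ μ : ℝ, (A p).HasEigenvalue μ → μ = 0 ∨ μ = RiggedNull.curvatureValue gb x N α p) ∧
        (RiggedNull.curvatureValue gb x N α p ≠ 0 →
          (A p).eigenspace 0 = RiggedNull.screen gb x N p ∧
          (A p).eigenspace (RiggedNull.curvatureValue gb x N α p) =
            RiggedNull.radical gb x p) := by
  have h : RiggedNull.IsNullRigging gb x N :=
    { metric := hgb
      smooth_map := hx.contMDiff
      injective := fun p ↦ RiggedNull.mfderiv_injective_of_isImmersionAt (hx.isImmersion.isImmersionAt p)
      nullHypersurface := hnull
      smooth := hN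
      null := fun y ↦ (hN_lightlike y).2
      transversal := hN_rigging }
  refine ⟨h.isSemiRiemannianMetric_twisted hα, h.isSemiRiemannianMetric_associated hα hα_ne,
    RiggedNull.pullBilin_twisted, h.isUnitNormal_gaussMap hα hα_ne,
    fun p ↦ RiggedNull.curvatureValue gb x N α p •
      (RiggedNull.eta gb x N p).toLinearMap.smulRight (RiggedNull.rigged gb x N p), ?_, ?_⟩
  · intro p v
    rw [h.covDerivAlong_gaussMap hN_closed hα hα_ne hα_leaves hconf p v, RiggedNull.riggedAlong,
      neg_smul, ← map_smul]
    simp [smul_smul]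
  · intro p
    set μ₀ := RiggedNull.curvatureValue gb x N α p
    set A : Module.End ℝ (TangentSpace (𝓡 n) p) := μ₀ •
      (RiggedNull.eta gb x N p).toLinearMap.smulRight (RiggedNull.rigged gb x N p) with hA
    have hAv : ∀ v, A v = (μ₀ * RiggedNull.eta gb x N p v) • RiggedNull.rigged gb x N p := by
      intro v
      simp [hA, smul_smul]
    have hscreen : ∀ v ∈ RiggedNull.screen gb x N p, A v = 0 := by
      intro v hv
      rw [hAv, RiggedNull.mem_screen.mp hv, mul_zero, zero_smul]
    have hrad : ∀ v ∈ RiggedNull.radical gb x p, A v = μ₀ • v := by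
      intro v hv
      conv_rhs => rw [h.eq_smul_rigged hv, smul_smul]
      exact hAv v
    -- a vector with `A v = μ v` for `μ ≠ 0` is a multiple of `ξ`
    have heig : ∀ (μ : ℝ) v, A v = μ • v → μ ≠ 0 → v ∈ RiggedNull.radical gb x p := by
      intro μ v hv hμ
      have : v = μ⁻¹ • A v := by rw [hv, smul_smul, inv_mul_cancel₀ hμ, one_smul]
      rw [this, hAv]
      exact Submodule.smul_mem _ _ (Submodule.smul_mem _ _ (h.rigged_spec p).1)
    refine ⟨h.isCompl p, h.finrank_screen p, h.finrank_radical p, hscreen, hrad, ?_, ?_⟩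
    · intro μ hμ
      obtain ⟨v, hv⟩ := hμ.exists_hasEigenvector
      by_contra! hne
      have hAμ := hv.apply_eq_smul
      have h1 := hrad v (heig μ v hAμ hne.1)
      rw [hAμ, ← sub_eq_zero, ← sub_smul] at h1
      rcases smul_eq_zero.mp h1 with h2 | h2
      · exact hne.2 (sub_eq_zero.mp h2)
      · exact hv.2 h2
    · intro hμ₀
      constructor
      · ext v
        rw [Module.End.mem_eigenspace_iff, zero_smul, hAv, RiggedNull.mem_screen]
        constructor
        · intro hv
          exact (mul_eq_zero.mp ((smul_eq_zero.mp hv).resolve_right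
            (h.rigged_ne_zero p))).resolve_left hμ₀
        · intro hv
          rw [hv, mul_zero, zero_smul]
      · ext v
        rw [Module.End.mem_eigenspace_iff]
        exact ⟨fun hv ↦ heig _ v hv hμ₀, hrad v⟩
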